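/- **Conventions.** Let $\mathbf a$ be an essentially small additive category. $\mathsf{PSh}\,\mathbf a$ is the category of additive functors $\mathbf a^{\mathrm{op}}\to\mathsf{Ab}$, with Yoneda embedding $\mathtt Y$. A sieve on $X\in\mathbf a$ is a subfunctor $R\subset\mathbf a(-,X)$ in $\mathsf{PSh}\,\mathbf a$. A Grothendieck topology $\mathcal T$ on a preadditive category is a family of sets $\mathcal T(X)$ of sieves on $X$ such that $\mathbf a(-,X)\in\mathcal T(X)$; $f^{-1}R\in\mathcal T(Y)$ for $R\in\mathcal T(X)$ and $f:Y\to X$; and $R\in\mathcal T(X)$ whenever there is $S\in\mathcal T(X)$ with $f^{-1}R\in\mathcal T(Y)$ for all $f\in S(Y)$ and all $Y$. The set of these is $\mathrm{Top}(\mathbf a)$. $\mathsf{Sh}(\mathbf a,\mathcal T)\subset\mathsf{PSh}\,\mathbf a$ is the full subcategory of those $F$ for which $F(X)\to\mathsf{PSh}\,\mathbf a(R,F)$ is bijective for all $R\in\mathcal T(X)$, and $\mathtt Z:\mathbf a\to\mathsf{Sh}(\mathbf a,\mathcal T)$ is $\mathtt Y$ followed by sheafification. $\mathsf{Noy}\,\mathbf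 a$ is the category whose objects are the morphisms of $\mathbf a$; a morphism from $f:X^0\to X^1$ to $g:Y^0\to Y^1$ is a class of $\alpha:X^0\to Y^0$ such that $g\alpha$ factors via $f$, where $\alpha\sim\alpha'$ if $\alpha-\alpha'$ factors via $f$. Let $\mathtt N:\mathbf a\to\mathsf{Noy}\,\mathbf a$, $A\mapsto(A\to0)$. The set of homological topologies is $\mathrm{HTop}(\mathbf a)=\mathrm{Top}(\mathsf{Noy}\,\mathbf a)$; for $\mathcal R\in\mathrm{HTop}(\mathbf a)$ put $\mathsf{HSh}(\mathbf a,\mathcal R)=\mathsf{Sh}(\mathsf{Noy}\,\mathbf a,\mathcal R)$ and $\mathtt{HZ}=\mathtt Z\circ\mathtt N:\mathbf a\to\mathsf{HSh}(\mathbf a,\mathcal R)$. For $f\in\mathsf{Noy}\,\mathbf a$, $R_f$ is the sieve on $f$ generated by all morphisms $\mathtt N Y\to f$, $Y\in\mathbf a$. An additive functor $\theta:\mathbf a\to\mathbf C$ to a cocomplete abelian category is prexact if its left Kan extension along $\mathtt Y$ (the essentially unique cocontinuous $\Theta:\mathsf{PSh}\,\mathbf a\to\mathbf C$ with $\Theta\circ\mathtt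 Y\cong\theta$) is left exact. Then $\mathcal T_\theta$ is the topology on $\mathbf a$ in which $R$ covers $X$ if $R$ contains morphisms $Y_\beta\to X$ such that $\bigoplus_\beta\theta(Y_\beta)\to\theta(X)$ is an epimorphism. Let $\vec\theta:\mathsf{Noy}\,\mathbf a\to\mathbf C$, $f\mapsto\ker\theta(f)$; whenever $\vec\theta$ is prexact, put $\mathcal{HT}_\theta=\mathcal T_{\vec\theta}\in\mathrm{HTop}(\mathbf a)$. For an additive functor $u:\mathbf a\to\mathbf b$ between essentially small additive categories, the partial function $u_t:\mathrm{Top}(\mathbf b)\rightharpoonup\mathrm{Top}(\mathbf a)$ is defined at $\mathcal T$ if and only if $\mathtt Z\circ u$ is prexact for $\mathtt Z:\mathbf b\to\mathsf{Sh}(\mathbf b,\mathcal T)$, and then $u_t(\mathcal T)=\mathcal T_{\mathtt Z\circ u}$. **Theorem.** There are injections $\iota=\iota_{\mathbf a}:\mathrm{Top}(\mathbf a)\hookrightarrow\mathrm{HTop}(\mathbf a)$, for all essentially small additive categories $\mathbf a$, with the following properties. 1. For each $\mathcal T\in\mathrm{Top}(\mathbf a)$ there is an equivalence $E:\mathsf{Sh}(\mathbf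 a,\mathcal T)\simeq\mathsf{HSh}(\mathbf a,\iota(\mathcal T))$ with $E\circ\mathtt Z\cong\mathtt{HZ}$. 2. For each prexact functor $\theta:\mathbf a\to\mathbf C$ to a cocomplete abelian category, $\mathcal T_\theta$ is a Grothendieck topology, $\vec\theta$ is prexact, $\mathcal{HT}_\theta$ is a Grothendieck topology, and $\iota(\mathcal T_\theta)=\mathcal{HT}_\theta$. 3. The image of $\iota$ consists of the Grothendieck topologies $\mathcal R$ on $\mathsf{Noy}\,\mathbf a$ for which $R_f\in\mathcal R(f)$ for every object $f$ of $\mathsf{Noy}\,\mathbf a$. 4. For each additive functor $u:\mathbf a\to\mathbf b$ between essentially small additive categories, $\overrightarrow{\mathtt{HZ}\circ u}$ is prexact for each $\mathtt{HZ}:\mathbf b\to\mathsf{HSh}(\mathbf b,\mathcal R)$, and the partial function $u_t$ is the restriction along $\iota$, in source and target, of the function $$\Phi:\mathrm{HTop}(\mathbf b)\to\mathrm{HTop}(\mathbf a),\quad \mathcal R\mapsto\mathcal{HT}_{\mathtt{HZ}\circ u}.$$ That is, for $\mathcal T\in\mathrm{Top}(\mathbf b)$ and $\mathcal T'\in\mathrm{Top}(\mathbf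 a)$, $u_t(\mathcal T)$ is defined and equal to $\mathcal T'$ if and only if $\Phi(\iota(\mathcal T))=\iota(\mathcal T')$. -/

import Mathlib

open CategoryTheory Limits Opposite

universe w v₁ v u

noncomputable section

namespace HomologicalTopology

section Presheaves

variable (a : Type u) [Category.{v} a] [Preadditive a]

/-- The category of additive presheaves of abelian groups on `a`. -/
abbrev PSh : Type (max u (v + 1)) := aᵒᵖ ⥤+ AddCommGrpCat.{v}

instance (J : Type w) [Category.{v₁} J] [HasColimitsOfShape J AddCommGrpCat.{v}] :
    (additiveFunctor aᵒᵖ AddCommGrpCat.{v}).IsClosedUnderColimitsOfShape J where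
  colimitsOfShape_le := by
    rintro F ⟨p⟩
    have hj (j : J) : (p.diag.obj j).Additive := p.prop_diag_obj j
    refine ⟨fun {X Y f g} => ?_⟩
    refine (isColimitOfPreserves ((evaluation _ _).obj X) p.isColimit).hom_ext fun j => ?_
    have nat (h : X ⟶ Y) := (p.ι.app j).naturality h
    simp only [Functor.const_obj_obj] at nat
    simp only [Functor.mapCocone_ι_app, evaluation_obj_map, Preadditive.comp_add]
    rw [← nat, ← nat, ← nat, (hj j).map_add, Preadditive.add_comp]

instance (J : Type w) [Category.{v₁} J] [HasLimitsOfShape J AddCommGrpCat.{v}] :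
    (additiveFunctor aᵒᵖ AddCommGrpCat.{v}).IsClosedUnderLimitsOfShape J where
  limitsOfShape_le := by
    rintro F ⟨p⟩
    have hj (j : J) : (p.diag.obj j).Additive := p.prop_diag_obj j
    refine ⟨fun {X Y f g} => ?_⟩
    refine (isLimitOfPreserves ((evaluation _ _).obj Y) p.isLimit).hom_ext fun j => ?_
    have nat (h : X ⟶ Y) := (p.π.app j).naturality h
    simp only [Functor.const_obj_obj] at nat
    simp only [Functor.mapCone_π_app, evaluation_obj_map, Preadditive.add_comp]
    rw [nat, nat, nat, (hj j).map_add, Preadditive.comp_add]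

instance : HasColimitsOfSize.{v, v} (PSh a) where
instance : HasLimitsOfSize.{v, v} (PSh a) where

/-- The Yoneda embedding `a ⥤ PSh a`. -/
def yonedaPSh : a ⥤ PSh a :=
  ObjectProperty.lift _ preadditiveYoneda fun X => inferInstanceAs (preadditiveYoneda.obj X).Additive

instance : (yonedaPSh a).Additive where
  map_add := by
    intro X Y f g
    ext Z (h : Z.unop ⟶ X)
    exact Preadditive.comp_add _ _ _ h f g

variable {a}

/-- The morphism `Y(X) ⟶ F` given by an element of `F(X)`. -/
def ofElement {F : PSh a} {X : a} (x : F.obj.obj (op X)) : (yonedaPSh a).obj X ⟶ F :=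
  ObjectProperty.homMk
    { app Z := AddCommGrpCat.ofHom
        (AddMonoidHom.mk' (fun (g : Z.unop ⟶ X) => F.obj.map g.op x) fun g h =>
          ConcreteCategory.congr_hom (F.property.map_add (f := g.op) (g := h.op)) x)
      naturality Z Z' g := by
        ext (h : Z.unop ⟶ X)
        change F.obj.map (g.unop ≫ h).op x = F.obj.map g (F.obj.map h.op x)
        simp }

lemma ofElement_app {F : PSh a} {X : a} (x : F.obj.obj (op X)) {Z : a} (g : Z ⟶ X) :
    (ofElement x).hom.app (op Z) g = F.obj.map g.op x := rfl

lemma eq_ofElement {F : PSh a} {X : a} (m : (yonedaPSh a).obj X ⟶ F) :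
    m = ofElement (m.hom.app (op X) (𝟙 X)) := by
  ext Z (g : Z.unop ⟶ X)
  have := ConcreteCategory.congr_hom (m.hom.naturality g.op) (𝟙 X)
  refine Eq.trans ?_ this
  change m.hom.app Z g = m.hom.app Z (g ≫ 𝟙 X)
  rw [Category.comp_id]

lemma ofElement_comp {F G : PSh a} {X : a} (x : F.obj.obj (op X)) (m : F ⟶ G) :
    ofElement x ≫ m = ofElement (m.hom.app (op X) x) := by
  rw [eq_ofElement (ofElement x ≫ m)]
  congr 1
  change m.hom.app _ (F.obj.map (𝟙 X).op x) = _
  simp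

lemma ofElement_injective {F : PSh a} {X : a} :
    Function.Injective (ofElement : F.obj.obj (op X) → _) := by
  intro x y h
  have h' : (ofElement x).hom.app (op X) (𝟙 X) = (ofElement y).hom.app (op X) (𝟙 X) := by rw [h]
  rw [ofElement_app, ofElement_app] at h'
  simpa using h'

/-- The additive Yoneda lemma. -/
def yonedaEquivPSh (F : PSh a) (X : a) : ((yonedaPSh a).obj X ⟶ F) ≃ F.obj.obj (op X) where
  toFun m := m.hom.app (op X) (𝟙 X)
  invFun := ofElement
  left_inv m := (eq_ofElement m).symm
  right_inv _ := ofElement_injective (eq_ofElement _).symm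

end Presheaves

section Presentability

variable {a : Type u} [Category.{v} a] [Preadditive a]

instance (X : a) (κ : Cardinal.{v}) [Fact κ.IsRegular] :
    IsCardinalPresentable ((yonedaPSh a).obj X) κ where
  preservesColimitOfShape J _ _ := by
    have := isFiltered_of_isCardinalFiltered J κ
    let e : (additiveFunctor aᵒᵖ AddCommGrpCat.{v}).ι ⋙ (evaluation aᵒᵖ AddCommGrpCat.{v}).obj (op X) ⋙
        forget AddCommGrpCat.{v} ⋙ uliftFunctor.{u} ≅ coyoneda.obj (op ((yonedaPSh a).obj X)) :=
      NatIso.ofComponents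
        (fun F => Equiv.toIso (Equiv.ulift.trans (yonedaEquivPSh F X).symm))
        (fun {F G} m => by
          ext x
          exact (ofElement_comp x.down m).symm)
    exact preservesColimitsOfShape_of_natIso e

lemma isCokernel_of_exact {P Q F : PSh a} (r : P ⟶ Q) (π : Q ⟶ F) (h : r ≫ π = 0)
    (hπ : ∀ X, Function.Surjective (π.hom.app X))
    (hr : ∀ X y, π.hom.app X y = 0 → ∃ z, r.hom.app X z = y) :
    Nonempty (IsColimit (CokernelCofork.ofπ π h)) := by
  have hker {G : PSh a} (k : Q ⟶ G) (hk : r ≫ k = 0) (X : aᵒᵖ) :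
      (π.hom.app X).hom.ker ≤ (k.hom.app X).hom.ker := fun y hy => by
    obtain ⟨z, rfl⟩ := hr X y hy
    exact congr_arg (fun m => m.hom.app X z) hk
  let d {G : PSh a} (k : Q ⟶ G) (hk : r ≫ k = 0) (X : aᵒᵖ) : F.obj.obj X →+ G.obj.obj X :=
    AddMonoidHom.liftOfSurjective (π.hom.app X).hom (hπ X) ⟨(k.hom.app X).hom, hker k hk X⟩
  have hd {G : PSh a} (k : Q ⟶ G) (hk : r ≫ k = 0) (X : aᵒᵖ) (y : Q.obj.obj X) :
      d k hk X (π.hom.app X y) = k.hom.app X y :=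
    AddMonoidHom.liftOfRightInverse_comp_apply _ _ _ ⟨(k.hom.app X).hom, hker k hk X⟩ y
  refine ⟨CokernelCofork.IsColimit.ofπ _ _ (fun {G} k hk => ObjectProperty.homMk
    { app X := AddCommGrpCat.ofHom (d k hk X)
      naturality X Y f := ?_ }) (fun {G} k hk => ?_) (fun {G} k hk m hm => ?_)⟩
  · ext x
    obtain ⟨y, rfl⟩ := hπ X x
    have h1 := ConcreteCategory.congr_hom (π.hom.naturality f) y
    have h2 := ConcreteCategory.congr_hom (k.hom.naturality f) y
    change d k hk Y (F.obj.map f (π.hom.app X y)) = G.obj.map f (d k hk X (π.hom.app X y))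
    rw [hd k hk]
    exact ((congr_arg (d k hk Y) h1.symm).trans (hd k hk Y _)).trans h2
  · ext X y
    exact hd k hk X y
  · ext X x
    obtain ⟨y, rfl⟩ := hπ X x
    refine Eq.trans ?_ (hd k hk X y).symm
    exact congr_arg (fun m => m.hom.app X y) hm

variable [EssentiallySmall.{v} a]

/-- An object of `a` corresponding to an element of a fixed small model of `a`. -/
abbrev ofModel (Z : SmallModel.{v} a) : a := (equivSmallModel.{v} a).inverse.obj Z

/-- Every object is isomorphic to one in the small model. -/
def isoModel (X : a) : X ≅ ofModel ((equivSmallModel.{v} a).functor.obj X) :=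
  (equivSmallModel.{v} a).unitIso.app X

/-- The coproduct of representables indexed by the elements of a presheaf that satisfy `p`. -/
abbrev cover (F : PSh a) (p : ∀ X : a, F.obj.obj (op X) → Prop) : PSh a :=
  ∐ fun i : (Σ Z : SmallModel.{v} a, {x : F.obj.obj (op (ofModel Z)) // p (ofModel Z) x}) =>
    (yonedaPSh a).obj (ofModel i.1)

/-- The canonical morphism from this coproduct. -/
def coverMap (F : PSh a) (p : ∀ X : a, F.obj.obj (op X) → Prop) : cover F p ⟶ F :=
  Sigma.desc fun i => ofElement i.2.1

lemma exists_coverMap (F : PSh a) (p : ∀ X : a, F.obj.obj (op X) → Prop)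
    (hp : ∀ (X Y : a) (f : X ⟶ Y) (x : F.obj.obj (op Y)), p Y x → p X (F.obj.map f.op x))
    (X : a) (x : F.obj.obj (op X)) (hx : p X x) : ∃ y, (coverMap F p).hom.app _ y = x := by
  have key (Z : SmallModel.{v} a) (x : F.obj.obj (op (ofModel Z))) (hx : p (ofModel Z) x) :
      ∃ y, (coverMap F p).hom.app _ y = x := by
    refine ⟨(Sigma.ι (fun i : (Σ Z : SmallModel.{v} a,
      {x : F.obj.obj (op (ofModel Z)) // p (ofModel Z) x}) =>
      (yonedaPSh a).obj (ofModel i.1)) ⟨Z, x, hx⟩).hom.app _ (𝟙 (ofModel Z)), ?_⟩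
    have := Sigma.ι_desc (fun i : (Σ Z : SmallModel.{v} a,
      {x : F.obj.obj (op (ofModel Z)) // p (ofModel Z) x}) => ofElement i.2.1) ⟨Z, x, hx⟩
    have := congr_arg (fun m => m.hom.app (op (ofModel Z)) (𝟙 (ofModel Z))) this
    refine this.trans ?_
    change (ofElement x).hom.app _ (𝟙 _) = x
    rw [ofElement_app]
    simp
  obtain ⟨y, hy⟩ := key _ (F.obj.map (isoModel X).inv.op x) (hp _ _ _ _ hx)
  refine ⟨(cover F p).obj.map (isoModel X).hom.op y, ?_⟩
  refine Eq.trans (ConcreteCategory.congr_hom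
    ((coverMap F p).hom.naturality (isoModel X).hom.op) y) ?_
  change F.obj.map _ ((coverMap F p).hom.app _ y) = _
  rw [hy, ← ConcreteCategory.comp_apply, ← F.obj.map_comp, ← op_comp, Iso.hom_inv_id]
  simp

lemma coverMap_comp_eq_zero (F : PSh a) (p : ∀ X : a, F.obj.obj (op X) → Prop) {G : PSh a}
    (m : F ⟶ G) (hm : ∀ X x, p X x → m.hom.app (op X) x = 0) : coverMap F p ≫ m = 0 := by
  refine Sigma.hom_ext _ _ fun i => ?_
  rw [coverMap, Sigma.ι_desc_assoc, ofElement_comp, hm _ _ i.2.2, comp_zero]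
  ext Z g
  exact map_zero (G.obj.map (Quiver.Hom.op g)).hom

/-- Presheaves form a locally small category. -/
instance : LocallySmall.{v} (PSh a) where
  hom_small F G := by
    refine small_of_injective (β := ∀ Z : SmallModel.{v} a,
      F.obj.obj (op (ofModel Z)) → G.obj.obj (op (ofModel Z)))
      (f := fun m Z x => m.hom.app _ x) fun m n h => ?_
    ext X x
    have key (k : F ⟶ G) : k.hom.app X x = G.obj.map (isoModel X.unop).hom.op
        (k.hom.app _ (F.obj.map (isoModel X.unop).inv.op x)) := by
      rw [← ConcreteCategory.comp_apply, ← ConcreteCategory.comp_apply,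
        ← k.hom.naturality, ← F.obj.map_comp_assoc, ← op_comp, Iso.hom_inv_id]
      simp
    rw [key m, key n]
    congr 1
    exact congr_fun (congr_fun h _) _

lemma exists_regular_presentable {I : Type w} [Small.{v} I] (F : I → PSh a) :
    ∃ (κ : Cardinal.{v}) (_ : Fact κ.IsRegular), ∀ i, IsCardinalPresentable (F i) κ := by
  let Q (i : I) := cover (F i) fun _ _ => True
  let π (i : I) : Q i ⟶ F i := coverMap (F i) _
  let p (i : I) (X : a) (y : (Q i).obj.obj (op X)) : Prop := (π i).hom.app (op X) y = 0
  obtain ⟨κ, hκ, h⟩ := HasCardinalLT.exists_regular_cardinal_forall.{v} (ι := I)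
    (fun i => (Σ Z : SmallModel.{v} a, (F i).obj.obj (op (ofModel Z))) ⊕
      (Σ Z : SmallModel.{v} a, (Q i).obj.obj (op (ofModel Z))))
  have : Fact κ.IsRegular := ⟨hκ⟩
  have hcover (G : PSh a) (q : ∀ X : a, G.obj.obj (op X) → Prop)
      (hG : HasCardinalLT (Σ Z : SmallModel.{v} a, G.obj.obj (op (ofModel Z))) κ) :
      IsCardinalPresentable (cover G q) κ := by
    have (k : Discrete (Σ Z : SmallModel.{v} a,
        {x : G.obj.obj (op (ofModel Z)) // q (ofModel Z) x})) :
        IsCardinalPresentable ((Discrete.functor fun i : (Σ Z : SmallModel.{v} a,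
          {x : G.obj.obj (op (ofModel Z)) // q (ofModel Z) x}) =>
          (yonedaPSh a).obj (ofModel i.1)).obj k) κ :=
      inferInstanceAs (IsCardinalPresentable ((yonedaPSh a).obj _) κ)
    refine isCardinalPresentable_of_isColimit _ (colimit.isColimit _) κ ?_
    rw [hasCardinalLT_arrow_discrete_iff]
    exact hG.of_injective (fun i => ⟨i.1, i.2.1⟩) (by
      rintro ⟨Z, x, hx⟩ ⟨Z', x', hx'⟩ h
      obtain ⟨rfl, h⟩ := Sigma.mk.inj_iff.1 h
      obtain rfl := eq_of_heq h
      rfl)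
  refine ⟨κ, this, fun i => ?_⟩
  have h1 : IsCardinalPresentable (Q i) κ :=
    hcover _ _ ((h i).of_injective Sum.inl Sum.inl_injective)
  have h2 : IsCardinalPresentable (cover (Q i) (p i)) κ :=
    hcover _ _ ((h i).of_injective Sum.inr Sum.inr_injective)
  obtain ⟨hc⟩ := isCokernel_of_exact (coverMap (Q i) (p i)) (π i)
    (coverMap_comp_eq_zero _ _ _ fun _ _ h => h)
    (fun X x => exists_coverMap _ _ (fun _ _ _ _ _ => trivial) X.unop x trivial)
    (fun X y hy => exists_coverMap _ _ (fun X Y f y hy => by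
      refine (ConcreteCategory.congr_hom ((π i).hom.naturality f.op) y).trans ?_
      change (F i).obj.map _ ((π i).hom.app _ y) = 0
      rw [show (π i).hom.app _ y = 0 from hy, map_zero]) X.unop y hy)
  have (k : WalkingParallelPair) :
      IsCardinalPresentable ((parallelPair (coverMap (Q i) (p i)) 0).obj k) κ := by
    cases k
    · exact h2
    · exact h1
  exact isCardinalPresentable_of_isColimit _ hc κ
    (hasCardinalLT_of_finite _ _ hκ.aleph0_le)

end Presentability

section Topologies

variable {a : Type u} [Category.{v} a] [Preadditive a]

/-- An (additive) sieve on `X`: a subfunctor `R ⊆ a(-, X)` in the category of additive presheaves. -/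
@[ext]
structure AddSieve (X : a) where
  /-- the subgroup `R(Y)` of `a(Y, X)` -/
  arrows (Y : a) : AddSubgroup (Y ⟶ X)
  comp_mem {Y Z : a} (g : Z ⟶ Y) {f : Y ⟶ X} (hf : f ∈ arrows Y) : g ≫ f ∈ arrows Z

namespace AddSieve

/-- The maximal sieve `a(-, X)`. -/
def maximal (X : a) : AddSieve X where
  arrows _ := ⊤
  comp_mem _ _ _ := trivial

/-- The inverse image `f⁻¹R` of a sieve `R` on `X` along `f : Y ⟶ X`. -/
def pullback {X Y : a} (f : Y ⟶ X) (R : AddSieve X) : AddSieve Y where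
  arrows Z := (R.arrows Z).comap (Preadditive.rightComp Z f)
  comp_mem {Z W} g h hh := by
    change (g ≫ h) ≫ f ∈ R.arrows W
    rw [Category.assoc]
    exact R.comp_mem g hh

/-- The sieve on `X` generated by a family of morphisms `f i : Y i ⟶ X`. -/
def generate {X : a} {I : Type w} {Y : I → a} (f : ∀ i, Y i ⟶ X) : AddSieve X where
  arrows Z := AddSubgroup.closure {h | ∃ (i : I) (k : Z ⟶ Y i), k ≫ f i = h}
  comp_mem {Z W} g h hh := by
    refine AddSubgroup.closure_induction (p := fun h _ => g ≫ h ∈ AddSubgroup.closure _)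
      ?_ ?_ ?_ ?_ hh
    · rintro _ ⟨i, k, rfl⟩
      exact AddSubgroup.subset_closure ⟨i, g ≫ k, by simp⟩
    · simp
    · intro x y _ _ hx hy
      rw [Preadditive.comp_add]
      exact add_mem hx hy
    · intro x _ hx
      rw [Preadditive.comp_neg]
      exact neg_mem hx

/-- A sieve regarded as an additive presheaf. -/
def toPSh {X : a} (R : AddSieve X) : PSh a :=
  ⟨{ obj Y := AddCommGrpCat.of (R.arrows Y.unop)
     map {Y Z} g := AddCommGrpCat.ofHom
       (AddMonoidHom.mk' (fun f : R.arrows Y.unop => ⟨g.unop ≫ f.1, R.comp_mem _ f.2⟩)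
         fun f f' => Subtype.ext (Preadditive.comp_add _ _ _ _ _ _))
     map_id Y := by
       ext f
       exact Category.id_comp f.1
     map_comp g h := by
       ext f
       exact Category.assoc h.unop g.unop f.1 },
   ⟨fun {Y Z g h} => by
      ext f
      exact Preadditive.add_comp _ _ _ g.unop h.unop f.1⟩⟩

/-- The inclusion of a sieve on `X` into the representable presheaf `a(-, X)`. -/
def incl {X : a} (R : AddSieve X) : R.toPSh ⟶ (yonedaPSh a).obj X :=
  ObjectProperty.homMk
    { app Y := AddCommGrpCat.ofHom (R.arrows Y.unop).subtype
      naturality _ _ _ := rfl }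

end AddSieve

variable (a) in
/-- A covering system assigns to every object a class of sieves on it. -/
abbrev CoveringSystem : Type (max u v) := ∀ X : a, Set (AddSieve X)

/-- A covering system is an (additive) Grothendieck topology if it contains the maximal sieves, is
stable under inverse images and is of local character. -/
structure IsTopology (T : CoveringSystem a) : Prop where
  maximal_mem (X : a) : AddSieve.maximal X ∈ T X
  pullback_mem {X Y : a} (f : Y ⟶ X) (R : AddSieve X) (hR : R ∈ T X) : R.pullback f ∈ T Y
  local_mem {X : a} (S R : AddSieve X) (hS : S ∈ T X)
    (hR : ∀ (Y : a) (f : Y ⟶ X), f ∈ S.arrows Y → R.pullback f ∈ T Y) : R ∈ T X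

variable (a) in
/-- The set of additive Grothendieck topologies on a preadditive category. -/
abbrev GTop : Type (max u v) := {T : CoveringSystem a // IsTopology T}

/-- The class of inclusions `R ⊆ a(-, X)` of covering sieves. -/
inductive coverings (T : GTop a) : MorphismProperty (PSh a)
  | mk {X : a} (R : AddSieve X) (hR : R ∈ T.1 X) : coverings T R.incl

/-- Sheaves: additive presheaves `F` such that `F(X) = PSh(a(-, X), F) ⟶ PSh(R, F)` is a bijection
for every covering sieve `R` of `X`. -/
abbrev isSheaf (T : GTop a) : ObjectProperty (PSh a) := (coverings T).isLocal

/-- The category of sheaves for an additive Grothendieck topology. -/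
abbrev Sh (T : GTop a) : Type (max u (v + 1)) := (isSheaf T).FullSubcategory

instance (T : GTop a) : HasLimitsOfSize.{v, v} (Sh T) where

variable [EssentiallySmall.{v} a]

instance (X : a) : Small.{v} (AddSieve X) := by
  refine small_of_injective (β := ∀ Z : SmallModel.{v} a, Set (ofModel Z ⟶ X))
    (f := fun R Z => (R.arrows (ofModel Z) : Set _)) fun R S h => ?_
  ext Y f
  have key (R : AddSieve X) : f ∈ R.arrows Y ↔ (isoModel Y).inv ≫ f ∈ R.arrows _ :=
    ⟨fun hf => R.comp_mem _ hf, fun hf => by simpa using R.comp_mem (isoModel Y).hom hf⟩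
  rw [key R, key S]
  exact Set.ext_iff.1 (congr_fun h _) _

lemma isSheaf_eq (T : GTop a) : isSheaf T = (MorphismProperty.ofHoms
    (fun i : (Σ Z : SmallModel.{v} a, {R : AddSieve (ofModel Z) // R ∈ T.1 (ofModel Z)}) =>
      i.2.1.incl)).isLocal := by
  apply le_antisymm
  · refine MorphismProperty.isLocal_antitone ?_
    rintro _ _ _ ⟨i⟩
    exact coverings.mk _ i.2.2
  · rintro F hF _ _ _ ⟨R, hR⟩
    rename_i X
    let e := isoModel X
    have h := hF _ (MorphismProperty.ofHoms.mk ⟨_, R.pullback e.inv, T.2.pullback_mem _ _ hR⟩)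
    let i : (R.pullback e.inv).toPSh ≅ R.toPSh :=
      { hom := ObjectProperty.homMk
          { app Y := AddCommGrpCat.ofHom (AddMonoidHom.mk' (fun f => ⟨f.1 ≫ e.inv, f.2⟩)
              fun f g => Subtype.ext (Preadditive.add_comp _ _ _ _ _ _))
            naturality Y Z g := by
              ext f
              exact Subtype.ext (Category.assoc _ _ _) }
        inv := ObjectProperty.homMk
          { app Y := AddCommGrpCat.ofHom (AddMonoidHom.mk' (fun f => ⟨f.1 ≫ e.hom, by
                change (f.1 ≫ e.hom) ≫ e.inv ∈ R.arrows Y.unop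
                simp⟩)
              fun f g => Subtype.ext (Preadditive.add_comp _ _ _ _ _ _))
            naturality Y Z g := by
              ext f
              exact Subtype.ext (Category.assoc _ _ _) }
        hom_inv_id := by
          ext Y f
          exact Subtype.ext (by change (f.1 ≫ e.inv) ≫ e.hom = f.1; simp)
        inv_hom_id := by
          ext Y f
          exact Subtype.ext (by change (f.1 ≫ e.hom) ≫ e.inv = f.1; simp) }
    have hi : R.incl = i.inv ≫ (R.pullback e.inv).incl ≫ (yonedaPSh a).map e.inv := by
      ext Y f
      change f.1 = (f.1 ≫ e.hom) ≫ e.inv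
      simp
    let e' := (yonedaPSh a).mapIso e
    have h1 : Function.Bijective (fun g : (yonedaPSh a).obj X ⟶ F => e'.inv ≫ g) :=
      (Iso.homFromEquiv e').bijective
    have h2 : Function.Bijective (fun g : (R.pullback e.inv).toPSh ⟶ F => i.inv ≫ g) :=
      (Iso.homFromEquiv i).bijective
    convert (h2.comp h).comp h1 using 1
    funext g
    simp [hi, e']

instance (T : GTop a) : (isSheaf T).ι.IsRightAdjoint := by
  rw [isSheaf_eq]
  obtain ⟨κ, hκ, h⟩ := exists_regular_presentable
    (fun i : (Σ Z : SmallModel.{v} a, {R : AddSieve (ofModel Z) // R ∈ T.1 (ofModel Z)}) =>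
      i.2.1.toPSh)
  refine MorphismProperty.isRightAdjoint_ι_isLocal _ κ ?_
  rintro _ _ _ ⟨i⟩
  exact ⟨h i, inferInstance⟩

/-- The sheafification functor, left adjoint to the inclusion of sheaves into presheaves. -/
def sheafify (T : GTop a) : PSh a ⥤ Sh T := (isSheaf T).ι.leftAdjoint

/-- Sheafification is left adjoint to the inclusion. -/
def sheafifyAdj (T : GTop a) : sheafify T ⊣ (isSheaf T).ι := Adjunction.ofIsRightAdjoint _

instance (T : GTop a) : (sheafify T).Additive := (sheafifyAdj T).left_adjoint_additive

instance (T : GTop a) : HasColimitsOfSize.{v, v} (Sh T) :=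
  letI : Reflective (isSheaf T).ι := ⟨_, sheafifyAdj T⟩
  hasColimits_of_reflective (isSheaf T).ι

/-- The functor `Z : a ⥤ Sh(a, T)`, the sheafification of the Yoneda embedding. -/
def sheafYoneda (T : GTop a) : a ⥤ Sh T := yonedaPSh a ⋙ sheafify T

instance (T : GTop a) : (sheafYoneda T).Additive :=
  inferInstanceAs (yonedaPSh a ⋙ sheafify T).Additive

end Topologies

section KernelCategory

open scoped ZeroObject

variable (a : Type u) [Category.{v} a] [Preadditive a]

/-- The kernel category `Noy a`; its objects are the morphisms of `a`. -/
structure Noy : Type (max u v) where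
  /-- the source of the morphism -/
  {X₀ : a}
  /-- the target of the morphism -/
  {X₁ : a}
  /-- the morphism -/
  hom : X₀ ⟶ X₁

namespace Noy

variable {a}

/-- The group of those `α : X⁰ ⟶ Y⁰` for which `g ∘ α` factors via `f`. -/
def admissible (f g : Noy a) : AddSubgroup (f.X₀ ⟶ g.X₀) :=
  (Preadditive.leftComp g.X₁ f.hom).range.comap (Preadditive.rightComp f.X₀ g.hom)

lemma mem_admissible {f g : Noy a} {α : f.X₀ ⟶ g.X₀} :
    α ∈ admissible f g ↔ ∃ β : f.X₁ ⟶ g.X₁, f.hom ≫ β = α ≫ g.hom := Iff.rfl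

/-- The group of those `α : X⁰ ⟶ Y` that factor via `f`. -/
def null (f : Noy a) (Y : a) : AddSubgroup (f.X₀ ⟶ Y) := (Preadditive.leftComp Y f.hom).range

lemma mem_null {f : Noy a} {Y : a} {α : f.X₀ ⟶ Y} :
    α ∈ null f Y ↔ ∃ h : f.X₁ ⟶ Y, f.hom ≫ h = α := Iff.rfl

/-- Morphisms in `Noy a`: admissible `α`, modulo those that factor via `f`. -/
def Hom (f g : Noy a) : Type v :=
  admissible f g ⧸ (null f g.X₀).addSubgroupOf (admissible f g)

instance (f g : Noy a) : AddCommGroup (Hom f g) :=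
  inferInstanceAs (AddCommGroup (_ ⧸ (null f g.X₀).addSubgroupOf (admissible f g)))

/-- The class of an admissible morphism. -/
def mkHom (f g : Noy a) : admissible f g →+ Hom f g := QuotientAddGroup.mk' _

lemma mkHom_surjective (f g : Noy a) : Function.Surjective (mkHom f g) :=
  QuotientAddGroup.mk'_surjective _

lemma mkHom_eq_iff {f g : Noy a} {α β : admissible f g} :
    mkHom f g α = mkHom f g β ↔ ∃ h : f.X₁ ⟶ g.X₀, f.hom ≫ h = β.1 - α.1 := by
  refine QuotientAddGroup.eq.trans ?_
  rw [AddSubgroup.mem_addSubgroupOf, mem_null]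
  simp [sub_eq_neg_add]

/-- Composition of admissible morphisms. -/
def compAdmissible {f g h : Noy a} (α : admissible f g) (β : admissible g h) : admissible f h :=
  ⟨α.1 ≫ β.1, by
    obtain ⟨γ, hγ⟩ := mem_admissible.1 α.2
    obtain ⟨δ, hδ⟩ := mem_admissible.1 β.2
    exact mem_admissible.2 ⟨γ ≫ δ, by
      rw [← Category.assoc, hγ, Category.assoc, hδ, Category.assoc]⟩⟩

/-- Composition in `Noy a`. -/
def comp {f g h : Noy a} : Hom f g → Hom g h → Hom f h :=
  Quotient.map₂ compAdmissible (by
    intro α α' hα β β' hβ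
    have hα := Quotient.sound hα
    have hβ := Quotient.sound hβ
    change mkHom f g α = mkHom f g α' at hα
    change mkHom g h β = mkHom g h β' at hβ
    apply Quotient.exact
    change mkHom f h _ = mkHom f h _
    rw [mkHom_eq_iff] at hα hβ ⊢
    obtain ⟨s, hs⟩ := hα
    obtain ⟨t, ht⟩ := hβ
    obtain ⟨γ, hγ⟩ := mem_admissible.1 α.2
    refine ⟨s ≫ β'.1 + γ ≫ t, ?_⟩
    change _ = α'.1 ≫ β'.1 - α.1 ≫ β.1
    rw [Preadditive.comp_add, ← Category.assoc, ← Category.assoc, hs, hγ, Category.assoc, ht]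
    simp)

lemma comp_mk {f g h : Noy a} (α : admissible f g) (β : admissible g h) :
    comp (mkHom f g α) (mkHom g h β) = mkHom f h (compAdmissible α β) := rfl

instance : Category.{v} (Noy a) where
  Hom := Hom
  id f := mkHom f f ⟨𝟙 _, mem_admissible.2 ⟨𝟙 _, by simp⟩⟩
  comp := comp
  id_comp {f g} m := by
    obtain ⟨α, rfl⟩ := mkHom_surjective f g m
    rw [comp_mk]
    congr 1
    exact Subtype.ext (Category.id_comp _)
  comp_id {f g} m := by
    obtain ⟨α, rfl⟩ := mkHom_surjective f g m
    rw [comp_mk]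
    congr 1
    exact Subtype.ext (Category.comp_id _)
  assoc {f g h k} m n p := by
    obtain ⟨α, rfl⟩ := mkHom_surjective f g m
    obtain ⟨β, rfl⟩ := mkHom_surjective g h n
    obtain ⟨γ, rfl⟩ := mkHom_surjective h k p
    simp only [comp_mk]
    congr 1
    exact Subtype.ext (Category.assoc _ _ _)

instance : Preadditive (Noy a) where
  homGroup f g := inferInstanceAs (AddCommGroup (Hom f g))
  add_comp f g h m m' n := by
    obtain ⟨α, rfl⟩ := mkHom_surjective f g m
    obtain ⟨α', rfl⟩ := mkHom_surjective f g m'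
    obtain ⟨β, rfl⟩ := mkHom_surjective g h n
    change comp (mkHom f g α + mkHom f g α') _ = comp _ _ + comp _ _
    rw [← map_add, comp_mk, comp_mk, comp_mk, ← map_add]
    congr 1
    exact Subtype.ext (Preadditive.add_comp _ _ _ _ _ _)
  comp_add f g h m n n' := by
    obtain ⟨α, rfl⟩ := mkHom_surjective f g m
    obtain ⟨β, rfl⟩ := mkHom_surjective g h n
    obtain ⟨β', rfl⟩ := mkHom_surjective g h n'
    change comp _ (mkHom g h β + mkHom g h β') = comp _ _ + comp _ _
    rw [← map_add, comp_mk, comp_mk, comp_mk, ← map_add]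
    congr 1
    exact Subtype.ext (Preadditive.comp_add _ _ _ _ _ _)

variable (a) in
/-- The functor from the arrow category to `Noy a`. -/
def ofArrow : Arrow a ⥤ Noy a where
  obj f := ⟨f.hom⟩
  map {f g} m := mkHom ⟨f.hom⟩ ⟨g.hom⟩ ⟨m.left, mem_admissible.2 ⟨m.right, m.w.symm⟩⟩
  map_id _ := rfl
  map_comp _ _ := rfl

instance [EssentiallySmall.{v} a] : EssentiallySmall.{v} (Noy a) := by
  rw [essentiallySmall_iff]
  refine ⟨?_, inferInstance⟩
  let e := (equivSmallModel.{v} a).symm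
  refine small_of_surjective (α := Σ X Y : SmallModel.{v} a, X ⟶ Y)
    (f := fun t => toSkeleton ((ofArrow a).obj (Arrow.mk (e.functor.map t.2.2)))) ?_
  intro s
  obtain ⟨f, rfl⟩ := Quotient.exists_rep s
  let i : Arrow.mk (e.functor.map (e.inverse.map f.hom)) ≅ Arrow.mk f.hom :=
    Arrow.isoMk (e.counitIso.app f.X₀) (e.counitIso.app f.X₁)
  exact ⟨⟨_, _, e.inverse.map f.hom⟩, Quotient.sound ⟨(ofArrow a).mapIso i⟩⟩

variable (a) in
/-- The functor `N : a ⥤ Noy a`, which sends `A` to `A ⟶ 0`. -/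
def N [HasZeroObject a] : a ⥤ Noy a where
  obj A := ⟨(0 : A ⟶ (0 : a))⟩
  map {A B} f := mkHom _ _ ⟨f, mem_admissible.2 ⟨0, by simp⟩⟩
  map_id _ := rfl
  map_comp _ _ := rfl

instance [HasZeroObject a] : (N a).Additive where
  map_add := rfl

/-- The sieve `R_f` on `f`, generated by all morphisms `N Y ⟶ f` with `Y` in `a`. -/
def canonicalSieve [HasZeroObject a] (f : Noy a) : AddSieve f :=
  AddSieve.generate fun i : (Σ Y : a, (N a).obj Y ⟶ f) => i.2

variable {C : Type w} [Category.{v₁} C] [Preadditive C] [HasKernels C]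

/-- The map on morphisms of the functor `f ↦ ker θ(f)`, on representatives. -/
def vecMap (θ : a ⥤ C) [θ.Additive] {f g : Noy a} (α : admissible f g) :
    kernel (θ.map f.hom) ⟶ kernel (θ.map g.hom) :=
  kernel.lift _ (kernel.ι _ ≫ θ.map α.1) (by
    obtain ⟨β, hβ⟩ := mem_admissible.1 α.2
    rw [Category.assoc, ← θ.map_comp, ← hβ, θ.map_comp, kernel.condition_assoc, zero_comp])

lemma vecMap_ι (θ : a ⥤ C) [θ.Additive] {f g : Noy a} (α : admissible f g) :
    vecMap θ α ≫ kernel.ι _ = kernel.ι _ ≫ θ.map α.1 := kernel.lift_ι _ _ _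

lemma vecMap_congr (θ : a ⥤ C) [θ.Additive] {f g : Noy a} {α β : admissible f g}
    (h : mkHom f g α = mkHom f g β) : vecMap θ α = vecMap θ β := by
  obtain ⟨s, hs⟩ := mkHom_eq_iff.1 h
  rw [← cancel_mono (kernel.ι _), vecMap_ι, vecMap_ι, ← sub_eq_zero, ← Preadditive.comp_sub,
    ← θ.map_sub, ← neg_sub, ← hs, θ.map_neg, θ.map_comp, Preadditive.comp_neg,
    kernel.condition_assoc, zero_comp, neg_zero]

/-- For an additive functor `θ : a ⥤ C`, the functor `Noy a ⥤ C` which sends `f` to `ker θ(f)`. -/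
def vec (θ : a ⥤ C) [θ.Additive] : Noy a ⥤ C where
  obj f := kernel (θ.map f.hom)
  map {f g} m := Quotient.lift (vecMap θ) (fun _ _ h => vecMap_congr θ (Quotient.sound h)) m
  map_id f := by
    change vecMap θ _ = 𝟙 _
    rw [← cancel_mono (kernel.ι _), vecMap_ι]
    simp
  map_comp {f g h} m n := by
    obtain ⟨α, rfl⟩ := mkHom_surjective f g m
    obtain ⟨β, rfl⟩ := mkHom_surjective g h n
    change vecMap θ (compAdmissible α β) = vecMap θ α ≫ vecMap θ β
    rw [← cancel_mono (kernel.ι _), Category.assoc, vecMap_ι, vecMap_ι, ← Category.assoc, vecMap_ι]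
    simp [compAdmissible]

end Noy

end KernelCategory

section Prexact

variable {a : Type u} [Category.{v} a] [Preadditive a] {C : Type w} [Category.{v₁} C]

/-- An additive functor `θ : a ⥤ C` to a cocomplete abelian category is prexact if its left Kan
extension along the Yoneda embedding, that is, the essentially unique cocontinuous functor
`Θ : PSh a ⥤ C` with `Θ ∘ Y ≅ θ`, is (left) exact. -/
def Prexact (θ : a ⥤ C) : Prop :=
  ∃ Θ : PSh a ⥤ C, PreservesColimitsOfSize.{v, v} Θ ∧ Nonempty (yonedaPSh a ⋙ Θ ≅ θ) ∧
    PreservesFiniteLimits Θ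

/-- The covering system of a functor `θ`: a sieve `R` on `X` is covering if it contains morphisms
`f i : Y i ⟶ X` for which `⨁ θ(Y i) ⟶ θ(X)` is an epimorphism. -/
def coveringSystem [HasCoproducts.{v} C] (θ : a ⥤ C) : CoveringSystem a := fun X =>
  {R | ∃ (I : Type v) (Y : I → a) (f : ∀ i, Y i ⟶ X), (∀ i, f i ∈ R.arrows (Y i)) ∧
    Epi (Sigma.desc fun i => θ.map (f i))}

end Prexact

section HomologicalTopologies

variable (a : Type u) [Category.{v} a] [Preadditive a]

/-- Homological topologies on `a` are Grothendieck topologies on `Noy a`. -/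
abbrev HTop : Type (max u v) := GTop (Noy a)

variable {a}

/-- The category of sheaves for a homological topology. -/
abbrev HSh (R : HTop a) : Type (max u (v + 1)) := Sh R

variable [HasZeroObject a] [EssentiallySmall.{v} a]

/-- The functor `HZ = Z ∘ N : a ⥤ HSh(a, R)`. -/
def homologicalYoneda (R : HTop a) : a ⥤ HSh R := Noy.N a ⋙ sheafYoneda R

instance (R : HTop a) : (homologicalYoneda R).Additive :=
  inferInstanceAs (Noy.N a ⋙ sheafYoneda R).Additive

end HomologicalTopologies

section PartialFunction

variable {a b : Type u} [Category.{v} a] [Preadditive a] [Category.{v} b] [Preadditive b]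
  [EssentiallySmall.{v} b]

/-- The partial function `u_t` from topologies on `b` to topologies on `a` induced by `u : a ⥤ b`:
if `Z ∘ u` is prexact, with `Z : b ⥤ Sh(b, T)`, then `u_t(T)` is the topology of `Z ∘ u`. (That the
covering system of a prexact functor is a topology is part of the statement of the theorem.) -/
def inducedTop (φ : a ⥤ b) : GTop b →. GTop a := fun T =>
  ⟨Prexact (φ ⋙ sheafYoneda T) ∧ IsTopology (coveringSystem (φ ⋙ sheafYoneda T)),
    fun h => ⟨_, h.2⟩⟩

end PartialFunction

end HomologicalTopology

end

open HomologicalTopology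

-- Call a functor on presheaves exact if it is cocontinuous and left exact. The whole argument rests
-- on one principle (`isIso_map_iff_of_coveringSystem_eq`): an exact functor into a suitable abelian
-- category is determined, as far as the morphisms that it inverts are concerned, by its covering
-- system. Indeed, whether it inverts a morphism depends on what it does to two monomorphisms, and
-- for a monomorphism this can be tested after base change to representables, that is, on sieves. By
-- `coveringSystem_sheafYoneda`, a topology `T` is itself the covering system of an exact functor,
-- its sheafification.
--
-- The functor `N` is fully faithful, and each object `f` of `Noy a` is the kernel of `N` applied to
-- the morphism `f`. Restriction of presheaves along `N` is exact, and its left adjoint `extend` is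
-- fully faithful, so restriction is a localization. The topology `ι(T)` is the covering system of
-- restriction followed by `T`-sheafification: a sieve on `f` covers if all its restrictions to
-- objects `N Y` over `f` do. Both this composite and `ι(T)`-sheafification are localizations at the
-- same morphisms, whence the equivalence of sheaf categories.
--
-- If `Θ` is the exact extension of `θ`, then restriction followed by `Θ` is exact, and on
-- representables it preserves the kernels above and extends `θ`. It is therefore the exact
-- extension of `vec θ`, and its covering system is `ι` of that of `θ`. Conversely, if every `R_f`
-- covers, coverings are detected on the objects `N Y`, so the topology is the image under `ι` of
-- one on `a`.
--
-- For functoriality, a functor `φ` induces a flat functor `Noy a ⥤ Noy b`. Extension along it is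
-- thus exact, and `vec (φ ⋙ HZ)` is always prexact. If the resulting topology is some `ι(T)`,
-- extension along `N` followed by the exact functor `Ψ` on presheaves over `Noy a` preserves
-- monomorphisms: the kernel that extension may create restricts to zero on `a`, and `Ψ` kills such
-- presheaves (`prexact_of_coveringSystem_eq_iota`).

universe u'

noncomputable section

namespace HomologicalTopology

/-! ### Additive presheaves computed on elements, and sieves as base changes -/

section PresheafBasics

variable {a : Type u} [Category.{v} a] [Preadditive a]

instance : (additiveFunctor aᵒᵖ AddCommGrpCat.{v}).IsClosedUnderKernels where
  kernels_le := by
    rintro _ ⟨f, k, hk, hX, hY⟩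
    exact ObjectProperty.prop_of_isLimit _ hk (by rintro (_ | _) <;> assumption)

instance : (additiveFunctor aᵒᵖ AddCommGrpCat.{v}).IsClosedUnderCokernels where
  cokernels_le := by
    rintro _ ⟨f, k, hk, hX, hY⟩
    exact ObjectProperty.prop_of_isColimit _ hk (by rintro (_ | _) <;> assumption)

instance : (additiveFunctor aᵒᵖ AddCommGrpCat.{v}).IsClosedUnderFiniteProducts :=
  ⟨fun _ => inferInstance⟩

instance : Abelian (PSh a) := inferInstance

instance : PreservesColimitsOfSize.{v, v} (additiveFunctor aᵒᵖ AddCommGrpCat.{v}).ι where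
  preservesColimitsOfShape := inferInstance

instance : PreservesLimitsOfSize.{v, v} (additiveFunctor aᵒᵖ AddCommGrpCat.{v}).ι where
  preservesLimitsOfShape := inferInstance

/-- Evaluation of additive presheaves at an object. -/
abbrev ev (X : a) : PSh a ⥤ AddCommGrpCat.{v} :=
  (additiveFunctor aᵒᵖ AddCommGrpCat.{v}).ι ⋙ (evaluation _ _).obj (op X)

instance (X : a) : PreservesColimitsOfSize.{v, v} (ev X) := comp_preservesColimits _ _

instance (X : a) : PreservesLimitsOfSize.{v, v} (ev X) := comp_preservesLimits _ _

instance (X : a) : PreservesFiniteLimits (ev X) := PreservesLimitsOfSize.preservesFiniteLimits _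

instance (X : a) : PreservesFiniteColimits (ev X) :=
  PreservesColimitsOfSize.preservesFiniteColimits _

lemma map_app {F G : PSh a} (m : F ⟶ G) {X Y : a} (g : Y ⟶ X) (x : F.obj.obj (op X)) :
    m.hom.app (op Y) (F.obj.map g.op x) = G.obj.map g.op (m.hom.app (op X) x) :=
  ConcreteCategory.congr_hom (m.hom.naturality g.op) x

lemma map_map (F : PSh a) {X Y Z : a} (g : Y ⟶ X) (h : Z ⟶ Y) (x : F.obj.obj (op X)) :
    F.obj.map h.op (F.obj.map g.op x) = F.obj.map (h ≫ g).op x := by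
  rw [op_comp, F.obj.map_comp]
  rfl

lemma map_id_apply (F : PSh a) {X : a} (x : F.obj.obj (op X)) : F.obj.map (𝟙 X).op x = x := by
  simp

lemma map_add_apply (F : PSh a) {X Y : a} (g h : Y ⟶ X) (x : F.obj.obj (op X)) :
    F.obj.map (g + h).op x = F.obj.map g.op x + F.obj.map h.op x :=
  ConcreteCategory.congr_hom (F.property.map_add (f := g.op) (g := h.op)) x

lemma map_zero_apply (F : PSh a) {X Y : a} (x : F.obj.obj (op X)) :
    F.obj.map (0 : Y ⟶ X).op x = 0 := by
  simp

lemma comp_app {F G H : PSh a} (m : F ⟶ G) (n : G ⟶ H) {X : a} (x : F.obj.obj (op X)) :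
    (m ≫ n).hom.app (op X) x = n.hom.app (op X) (m.hom.app (op X) x) := rfl

lemma zero_app {F G : PSh a} {X : a} (x : F.obj.obj (op X)) :
    (0 : F ⟶ G).hom.app (op X) x = 0 := rfl

lemma hom_ext_apply {F G : PSh a} {m n : F ⟶ G}
    (h : ∀ (X : a) (x : F.obj.obj (op X)), m.hom.app (op X) x = n.hom.app (op X) x) : m = n := by
  ext X x
  exact h X.unop x

lemma mono_iff_injective {F G : PSh a} (m : F ⟶ G) :
    Mono m ↔ ∀ X : a, Function.Injective (m.hom.app (op X)) := by
  refine ⟨fun _ X => ?_, fun h => ⟨fun p q hpq => hom_ext_apply fun X x => h X ?_⟩⟩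
  · exact (AddCommGrpCat.mono_iff_injective _).1 (inferInstanceAs (Mono ((ev X).map m)))
  · rw [← comp_app, hpq, comp_app]

lemma epi_iff_surjective {F G : PSh a} (m : F ⟶ G) :
    Epi m ↔ ∀ X : a, Function.Surjective (m.hom.app (op X)) := by
  refine ⟨fun _ X => ?_, fun h => ⟨fun p q hpq => hom_ext_apply fun X x => ?_⟩⟩
  · exact (AddCommGrpCat.epi_iff_surjective _).1 (inferInstanceAs (Epi ((ev X).map m)))
  · obtain ⟨x, rfl⟩ := h X x
    rw [← comp_app, hpq, comp_app]

lemma isIso_iff_bijective {F G : PSh a} (m : F ⟶ G) :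
    IsIso m ↔ ∀ X : a, Function.Bijective (m.hom.app (op X)) := by
  rw [isIso_iff_mono_and_epi, mono_iff_injective, epi_iff_surjective, ← forall_and]
  rfl

/-- A morphism of presheaves whose values lie in the image of a monomorphism lifts. -/
lemma exists_lift_of_injective {F G H : PSh a} (m : F ⟶ G) (h : H ⟶ G)
    (hm : ∀ X : a, Function.Injective (m.hom.app (op X)))
    (hh : ∀ (X : a) (x : H.obj.obj (op X)), ∃ y, m.hom.app (op X) y = h.hom.app (op X) x) :
    ∃ l : H ⟶ F, l ≫ m = h := by
  choose l hl using hh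
  refine ⟨ObjectProperty.homMk
    { app X := AddCommGrpCat.ofHom (AddMonoidHom.mk' (l X.unop) fun x y => hm _ ?_)
      naturality X Y g := ?_ }, hom_ext_apply hl⟩
  · erw [map_add, hl, hl, hl, map_add]
  · ext x
    refine hm _ ((hl _ _).trans ?_)
    refine (map_app h g.unop x).trans ?_
    refine Eq.trans ?_ (map_app m g.unop (l X.unop x)).symm
    rw [hl]

lemma isKernel_of_exact {F G H : PSh a} (i : F ⟶ G) (f : G ⟶ H) (w : i ≫ f = 0)
    (hi : ∀ X : a, Function.Injective (i.hom.app (op X)))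
    (hf : ∀ (X : a) (y : G.obj.obj (op X)), f.hom.app (op X) y = 0 →
      ∃ x, i.hom.app (op X) x = y) :
    Nonempty (IsLimit (KernelFork.ofι i w)) := by
  have := (mono_iff_injective i).2 hi
  have hl {K : PSh a} (k : K ⟶ G) (hk : k ≫ f = 0) : ∃ l : K ⟶ F, l ≫ i = k :=
    exists_lift_of_injective i k hi fun X x => hf X _ (by rw [← comp_app, hk, zero_app])
  exact ⟨KernelFork.IsLimit.ofι _ _ (fun k hk => (hl k hk).choose)
    (fun k hk => (hl k hk).choose_spec) fun k hk m hm => by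
      rw [← cancel_mono i, hm, (hl k hk).choose_spec]⟩

lemma exists_of_isColimit_cokernel {F G H : PSh a} {f : F ⟶ G} {p : G ⟶ H} {w : f ≫ p = 0}
    (hp : IsColimit (CokernelCofork.ofπ p w)) {X : a} {y : G.obj.obj (op X)}
    (hy : p.hom.app (op X) y = 0) : ∃ x, f.hom.app (op X) x = y := by
  have h := (ShortComplex.exact_of_g_is_cokernel (ShortComplex.mk f p w) hp).map (ev X)
  exact (ShortComplex.ab_exact_iff _).1 h y hy

/-- The sieve of those `g` for which `g^* y` lies in the image of `m`. -/
def sieveOf {A B : PSh a} (m : A ⟶ B) {X : a} (y : B.obj.obj (op X)) : AddSieve X where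
  arrows Z := (m.hom.app (op Z)).hom.range.comap
    (AddMonoidHom.mk' (fun g : Z ⟶ X => B.obj.map g.op y) fun g h => map_add_apply B g h y)
  comp_mem {Y Z} g f := by
    rintro ⟨x, hx⟩
    refine ⟨A.obj.map g.op x, ?_⟩
    exact ((map_app m g x).trans (congr_arg (B.obj.map g.op) hx)).trans (map_map B f g y)

lemma mem_sieveOf {A B : PSh a} {m : A ⟶ B} {X Z : a} {y : B.obj.obj (op X)} {g : Z ⟶ X} :
    g ∈ (sieveOf m y).arrows Z ↔ ∃ x, m.hom.app (op Z) x = B.obj.map g.op y := Iff.rfl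

lemma AddSieve.ext_iff_mem {X : a} {R S : AddSieve X} :
    R = S ↔ ∀ (Y : a) (f : Y ⟶ X), f ∈ R.arrows Y ↔ f ∈ S.arrows Y := by
  refine ⟨by rintro rfl; simp, fun h => ?_⟩
  ext Y f
  exact h Y f

lemma AddSieve.mem_pullback {X Y Z : a} {f : Y ⟶ X} {R : AddSieve X} {g : Z ⟶ Y} :
    g ∈ (R.pullback f).arrows Z ↔ g ≫ f ∈ R.arrows Z := Iff.rfl

lemma pullback_sieveOf {A B : PSh a} (m : A ⟶ B) {X Y : a} (f : Y ⟶ X) (y : B.obj.obj (op X)) :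
    (sieveOf m y).pullback f = sieveOf m (B.obj.map f.op y) := by
  rw [AddSieve.ext_iff_mem]
  intro Z g
  rw [AddSieve.mem_pullback, mem_sieveOf, mem_sieveOf, map_map]

/-- A morphism regarded as an element of a representable presheaf. -/
def yonedaElt {X Y : a} (f : Y ⟶ X) : ((yonedaPSh a).obj X).obj.obj (op Y) := f

lemma yonedaElt_surjective {X Y : a} :
    Function.Surjective (yonedaElt : (Y ⟶ X) → ((yonedaPSh a).obj X).obj.obj (op Y)) :=
  fun f => ⟨f, rfl⟩

lemma ofElement_yonedaElt {X Y : a} (f : Y ⟶ X) : ofElement (yonedaElt f) = (yonedaPSh a).map f :=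
  hom_ext_apply fun _ _ => rfl

/-- Makes inverse images of sieves a special case of base changes of monomorphisms of presheaves. -/
lemma sieveOf_incl {X Y : a} (R : AddSieve X) (f : Y ⟶ X) :
    sieveOf R.incl (yonedaElt f) = R.pullback f := by
  rw [AddSieve.ext_iff_mem]
  intro Z g
  refine ⟨?_, fun h => ⟨⟨g ≫ f, h⟩, rfl⟩⟩
  rintro ⟨x, hx⟩
  rw [AddSieve.mem_pullback, show g ≫ f = x.1 from hx.symm]
  exact x.2

lemma incl_injective {X : a} (R : AddSieve X) (Y : a) :
    Function.Injective (R.incl.hom.app (op Y)) := Subtype.val_injective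

instance {X : a} (R : AddSieve X) : Mono R.incl := (mono_iff_injective _).2 (incl_injective R)

/-- The inclusion of the sieve of `y` is a base change of `m`. -/
lemma exists_isPullback_sieveOf {A B : PSh a} (m : A ⟶ B) [Mono m] {X : a} (y : B.obj.obj (op X)) :
    ∃ t, IsPullback t (sieveOf m y).incl m (ofElement y) := by
  have hm := (mono_iff_injective m).1 inferInstance
  obtain ⟨t, ht⟩ := exists_lift_of_injective m ((sieveOf m y).incl ≫ ofElement y) hm
    fun Z g => g.2
  -- The commutativity of a cone says exactly that its second leg takes values in the sieve.
  have hl (s : PullbackCone m (ofElement y)) : ∃ l, l ≫ (sieveOf m y).incl = s.snd :=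
    exists_lift_of_injective _ _ (incl_injective _) fun Z x =>
      ⟨⟨s.snd.hom.app (op Z) x, s.fst.hom.app (op Z) x,
        congr_arg (fun k => k.hom.app (op Z) x) s.condition⟩, rfl⟩
  choose l hl using hl
  refine ⟨t, ⟨⟨ht⟩, ⟨PullbackCone.IsLimit.mk _ l (fun s => ?_) hl fun s k _ hk => ?_⟩⟩⟩
  · rw [← cancel_mono m, Category.assoc, ht, ← Category.assoc, hl, s.condition]
  · rw [← cancel_mono (sieveOf m y).incl, hk, hl]

lemma ofElement_incl {X Y : a} (R : AddSieve X) (f : R.toPSh.obj.obj (op Y)) :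
    ofElement f ≫ R.incl = (yonedaPSh a).map f.1 := hom_ext_apply fun _ _ => rfl

variable [EssentiallySmall.{v} a]

lemma coverMap_surjective (F : PSh a) (X : a) :
    Function.Surjective ((coverMap F fun _ _ => True).hom.app (op X)) :=
  fun x => exists_coverMap _ _ (fun _ _ _ _ _ => trivial) X x trivial

instance (F : PSh a) : Epi (coverMap F fun _ _ => True) :=
  (epi_iff_surjective _).2 (coverMap_surjective F)

end PresheafBasics

/-! ### Covering systems of functors and prexactness -/

section CoveringSystems

variable {a : Type u} [Category.{v} a] [Preadditive a] {C : Type w} [Category.{v₁} C]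

/-- Joint epimorphy of the family replaces the morphism out of a coproduct, so that the condition
can be carried along functors that are not known to preserve coproducts. -/
lemma mem_coveringSystem_iff [HasCoproducts.{v} C] {θ : a ⥤ C} {X : a} {R : AddSieve X} :
    R ∈ coveringSystem θ X ↔ ∃ (I : Type v) (Y : I → a) (f : ∀ i, Y i ⟶ X),
      (∀ i, f i ∈ R.arrows (Y i)) ∧ ∀ (W : C) (p q : θ.obj X ⟶ W),
        (∀ i, θ.map (f i) ≫ p = θ.map (f i) ≫ q) → p = q := by
  refine exists_congr fun I => exists_congr fun Y => exists_congr fun f => and_congr_right fun _ =>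
    ⟨fun h W p q hpq => ?_, fun h => ⟨fun {W} p q hpq => h W p q fun i => ?_⟩⟩
  · rw [← cancel_epi (Sigma.desc fun i => θ.map (f i))]
    exact Sigma.hom_ext _ _ fun i => by simpa using hpq i
  · simpa using Sigma.ι _ i ≫= hpq

lemma coveringSystem_congr [HasCoproducts.{v} C] {θ θ' : a ⥤ C} (e : θ ≅ θ') :
    coveringSystem θ = coveringSystem θ' := by
  have key {θ θ' : a ⥤ C} (e : θ ≅ θ') (X : a) : coveringSystem θ X ⊆ coveringSystem θ' X := by
    intro R hR
    rw [mem_coveringSystem_iff] at hR ⊢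
    obtain ⟨I, Y, f, hf, h⟩ := hR
    refine ⟨I, Y, f, hf, fun W p q hpq => ?_⟩
    rw [← cancel_epi (e.hom.app X)]
    refine h _ _ _ fun i => ?_
    rw [e.hom.naturality_assoc, e.hom.naturality_assoc, hpq]
  funext X
  exact (key e X).antisymm (key e.symm X)

lemma coveringSystem_comp_faithful_le [HasCoproducts.{v} C] {D : Type*} [Category* D]
    [HasCoproducts.{v} D] (θ : a ⥤ C) (E : C ⥤ D) [E.Faithful] (X : a) :
    coveringSystem (θ ⋙ E) X ⊆ coveringSystem θ X := by
  intro R hR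
  rw [mem_coveringSystem_iff] at hR ⊢
  obtain ⟨I, Y, f, hf, h⟩ := hR
  refine ⟨I, Y, f, hf, fun W p q hpq => E.map_injective (h _ _ _ fun i => ?_)⟩
  simpa using congr_arg E.map (hpq i)

lemma coveringSystem_comp_equivalence [HasCoproducts.{v} C] {D : Type*} [Category* D]
    [HasCoproducts.{v} D] (θ : a ⥤ C) (E : C ⥤ D) [E.IsEquivalence] :
    coveringSystem (θ ⋙ E) = coveringSystem θ := by
  funext X
  refine (coveringSystem_comp_faithful_le θ E X).antisymm ?_
  have := coveringSystem_comp_faithful_le (θ ⋙ E) E.inv X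
  rwa [coveringSystem_congr (show (θ ⋙ E) ⋙ E.inv ≅ θ from
    Functor.associator _ _ _ ≪≫ Functor.isoWhiskerLeft θ E.asEquivalence.unitIso.symm ≪≫
      θ.rightUnitor)] at this

lemma Prexact.of_iso {θ θ' : a ⥤ C} (h : Prexact θ) (e : θ ≅ θ') : Prexact θ' := by
  obtain ⟨Θ, h1, ⟨i⟩, h2⟩ := h
  exact ⟨Θ, h1, ⟨i ≪≫ e⟩, h2⟩

lemma Prexact.comp_equivalence {D : Type*} [Category* D] {θ : a ⥤ C} (h : Prexact θ)
    (E : C ⥤ D) [E.IsEquivalence] : Prexact (θ ⋙ E) := by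
  obtain ⟨Θ, _, ⟨e⟩, _⟩ := h
  exact ⟨Θ ⋙ E, inferInstance, ⟨Functor.isoWhiskerRight e E⟩, inferInstance⟩

instance preservesFiniteColimits_of_cocontinuous (Λ : PSh a ⥤ C)
    [PreservesColimitsOfSize.{v, v} Λ] : PreservesFiniteColimits Λ :=
  PreservesColimitsOfSize.preservesFiniteColimits _

instance preservesEpimorphisms_of_cocontinuous (Λ : PSh a ⥤ C)
    [PreservesColimitsOfSize.{v, v} Λ] : Λ.PreservesEpimorphisms :=
  preservesEpimorphisms_of_preservesColimitsOfShape Λ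

/-- A morphism is an epimorphism followed by the inclusion of its image, and `Λ` preserves
epimorphisms. This reduces questions about `Λ` to monomorphisms. -/
lemma epi_map_iff (Λ : PSh a ⥤ C) [PreservesColimitsOfSize.{v, v} Λ] {A B : PSh a}
    (f : A ⟶ B) : Epi (Λ.map f) ↔ Epi (Λ.map (Abelian.image.ι f)) := by
  have h : Λ.map f = Λ.map (Abelian.factorThruImage f) ≫ Λ.map (Abelian.image.ι f) := by
    rw [← Λ.map_comp, Abelian.image.fac]
  rw [h]
  exact ⟨fun _ => epi_of_epi (Λ.map (Abelian.factorThruImage f)) _, fun _ => epi_comp _ _⟩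

variable [EssentiallySmall.{v} a]

/-- A presheaf is a quotient of the coproduct of the representables given by its elements, and `Λ`
preserves both the coproduct and the quotient. -/
lemma hom_ext_of_cocontinuous (Λ : PSh a ⥤ C) [PreservesColimitsOfSize.{v, v} Λ] {F : PSh a}
    {W : C} (p q : Λ.obj F ⟶ W)
    (h : ∀ (Z : SmallModel.{v} a) (x : F.obj.obj (op (ofModel Z))),
      Λ.map (ofElement x) ≫ p = Λ.map (ofElement x) ≫ q) : p = q := by
  rw [← cancel_epi (Λ.map (coverMap F fun _ _ => True))]
  refine (isColimitOfPreserves Λ (colimit.isColimit _)).hom_ext fun i => ?_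
  have := h i.as.1 i.as.2.1
  have h' : (colimit.cocone _).ι.app i ≫ coverMap F (fun _ _ => True) = ofElement i.as.2.1 :=
    Sigma.ι_desc _ i.as
  rw [← h', Λ.map_comp, Category.assoc, Category.assoc] at this
  exact this

variable [HasCoproducts.{v} C]

/-- Any family in `R` factors through the inclusion of `R`; conversely the family of all elements of
`R` becomes jointly epimorphic onto `Λ(R)`. -/
lemma mem_coveringSystem_iff_epi (Λ : PSh a ⥤ C) [PreservesColimitsOfSize.{v, v} Λ] {X : a}
    {R : AddSieve X} : R ∈ coveringSystem (yonedaPSh a ⋙ Λ) X ↔ Epi (Λ.map R.incl) := by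
  rw [mem_coveringSystem_iff]
  constructor
  · rintro ⟨I, Y, f, hf, h⟩
    refine ⟨fun {W} p q hpq => h W p q fun i => ?_⟩
    have := ofElement_incl R (Y := Y i) ⟨f i, hf i⟩
    change Λ.map ((yonedaPSh a).map (f i)) ≫ p = Λ.map ((yonedaPSh a).map (f i)) ≫ q
    rw [← this, Λ.map_comp, Category.assoc, hpq, Category.assoc]
  · intro h
    -- All elements of `R` over the small model, which keeps the index type in `Type v`.
    refine ⟨Σ Z : SmallModel.{v} a, R.arrows (ofModel Z), fun i => ofModel i.1, fun i => i.2.1,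
      fun i => i.2.2, fun W p q hpq => ?_⟩
    rw [← cancel_epi (Λ.map R.incl)]
    refine hom_ext_of_cocontinuous Λ _ _ fun Z x => ?_
    have := hpq ⟨Z, x⟩
    change Λ.map ((yonedaPSh a).map _) ≫ p = Λ.map ((yonedaPSh a).map _) ≫ q at this
    rwa [← ofElement_incl, Λ.map_comp, Category.assoc, Category.assoc] at this

end CoveringSystems

/-! ### Exact functors on presheaves and the morphisms they invert -/

section ExactFunctors

open scoped ZeroObject

variable {a : Type u} [Category.{v} a] [Preadditive a]
  {C : Type w} [Category.{v₁} C] [Abelian C]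
  (Λ : PSh a ⥤ C) [PreservesColimitsOfSize.{v, v} Λ]

instance additive_of_cocontinuous : Λ.Additive := by
  have : Λ.PreservesZeroMorphisms := inferInstance
  have : PreservesBinaryBiproducts Λ := preservesBinaryBiproducts_of_preservesBinaryCoproducts _
  exact Functor.additive_of_preservesBinaryBiproducts _

/-- A cocontinuous functor that preserves monomorphisms is exact. -/
lemma preservesFiniteLimits_of_preservesMono
    (h : ∀ {A B : PSh a} (m : A ⟶ B) [Mono m], Mono (Λ.map m)) : PreservesFiniteLimits Λ := by
  -- Short exact sequences suffice: right exactness gives exactness in the middle, and the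
  -- hypothesis gives the monomorphism on the left.
  refine ((Functor.preservesFiniteLimits_tfae Λ).out 0 3).1 fun S hS => ?_
  have := hS.mono_f
  have h' := ((Functor.preservesFiniteColimits_tfae Λ).out 3 0 :).1 inferInstance S hS
  exact ⟨h'.1, h _⟩

variable [PreservesFiniteLimits Λ]

/-- The kernel of `Λ f` is `Λ (ker f)`, so the question is whether the latter vanishes. Vanishing is
expressed through the monomorphism `0 ⟶ ker f`, so that everything is reduced to which monomorphisms
become epimorphisms. -/
lemma mono_map_iff {A B : PSh a} (f : A ⟶ B) :
    Mono (Λ.map f) ↔ Epi (Λ.map (0 : 0 ⟶ kernel f)) := by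
  have h0 : IsZero (Λ.obj 0) := Λ.map_isZero (isZero_zero _)
  have hk : IsZero (Λ.obj (kernel f)) ↔ Epi (Λ.map (0 : 0 ⟶ kernel f)) := by
    rw [Λ.map_zero]
    exact ⟨fun h => ⟨fun _ _ _ => h.eq_of_src _ _⟩, fun _ => IsZero.of_epi_zero (Λ.obj 0) _⟩
  rw [← hk]
  constructor
  · intro h
    have h1 : Λ.map (kernel.ι f) = 0 := by
      rw [← cancel_mono (Λ.map f), ← Λ.map_comp, kernel.condition, Λ.map_zero, zero_comp]
    exact IsZero.of_mono_eq_zero _ h1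
  · exact fun h => Preadditive.mono_of_isZero_kernel' _
      (KernelFork.mapIsLimit _ (kernelIsKernel f) Λ) h

lemma isIso_map_iff {A B : PSh a} (f : A ⟶ B) : IsIso (Λ.map f) ↔
    Epi (Λ.map (0 : 0 ⟶ kernel f)) ∧ Epi (Λ.map (Abelian.image.ι f)) := by
  rw [isIso_iff_mono_and_epi, mono_map_iff, epi_map_iff Λ f]

variable [EssentiallySmall.{v} a]

/-- A monomorphism becomes invertible if and only if its base changes to representable presheaves
do. -/
lemma epi_map_iff_sieveOf {A B : PSh a} (m : A ⟶ B) [Mono m] : Epi (Λ.map m) ↔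
    ∀ (X : a) (y : B.obj.obj (op X)), Epi (Λ.map (sieveOf m y).incl) := by
  constructor
  · intro h X y
    obtain ⟨t, ht⟩ := exists_isPullback_sieveOf m y
    -- Exactness makes `Λ m` a monomorphism as well, and preserves the pullback square.
    have := isIso_of_mono_of_epi (Λ.map m)
    have := (ht.map Λ).isIso_snd_of_isIso
    infer_instance
  · refine fun h => ⟨fun {W} p q hpq => hom_ext_of_cocontinuous Λ p q fun Z x => ?_⟩
    obtain ⟨t, ht⟩ := exists_isPullback_sieveOf m x
    have := h _ x
    rw [← cancel_epi (Λ.map (sieveOf m x).incl), ← Λ.map_comp_assoc, ← Λ.map_comp_assoc, ← ht.w,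
      Λ.map_comp, Category.assoc, Category.assoc, hpq]

/-- Stability under inverse images is stability under base change of the inclusion of a sieve. For
local character, morphisms out of `Λ(X)` are tested on the elements of `S`, each of which factors
through `R` on a covering sieve. -/
lemma isTopology_of_exact [HasCoproducts.{v} C] :
    IsTopology (coveringSystem (yonedaPSh a ⋙ Λ)) where
  maximal_mem X := by
    rw [mem_coveringSystem_iff_epi]
    have : Epi (AddSieve.maximal X).incl :=
      (epi_iff_surjective _).2 fun Y f => ⟨⟨f, trivial⟩, rfl⟩
    infer_instance
  pullback_mem f R hR := by
    rw [mem_coveringSystem_iff_epi] at hR ⊢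
    rw [← sieveOf_incl]
    exact (epi_map_iff_sieveOf Λ R.incl).1 hR _ _
  local_mem {X} S R hS hR := by
    simp only [mem_coveringSystem_iff_epi] at hS hR ⊢
    refine ⟨fun {W} p q hpq => ?_⟩
    rw [← cancel_epi (Λ.map S.incl)]
    refine hom_ext_of_cocontinuous Λ _ _ fun Z x => ?_
    rw [← Λ.map_comp_assoc, ← Λ.map_comp_assoc, ofElement_incl]
    have : Epi (Λ.map (sieveOf R.incl (yonedaElt x.1)).incl) := by
      rw [sieveOf_incl]
      exact hR _ x.1 x.2
    obtain ⟨t, ht⟩ := exists_isPullback_sieveOf R.incl (yonedaElt x.1)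
    rw [← cancel_epi (Λ.map (sieveOf R.incl (yonedaElt x.1)).incl), ← ofElement_yonedaElt,
      ← Λ.map_comp_assoc, ← Λ.map_comp_assoc, ← ht.w, Λ.map_comp, Category.assoc, Category.assoc,
      hpq]

lemma Prexact.isTopology [HasCoproducts.{v} C] {θ : a ⥤ C} (h : Prexact θ) :
    IsTopology (coveringSystem θ) := by
  obtain ⟨Θ, _, ⟨e⟩, _⟩ := h
  rw [← coveringSystem_congr e]
  exact isTopology_of_exact Θ

/-- Exact cocontinuous functors that invert the same inclusions of sieves invert the same
morphisms. -/
lemma isIso_map_iff_of_coveringSystem_eq [HasCoproducts.{v} C] {D : Type*} [Category* D]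
    [Abelian D] [HasCoproducts.{v} D] (Λ' : PSh a ⥤ D) [PreservesColimitsOfSize.{v, v} Λ']
    [PreservesFiniteLimits Λ']
    (h : coveringSystem (yonedaPSh a ⋙ Λ) = coveringSystem (yonedaPSh a ⋙ Λ'))
    {A B : PSh a} (f : A ⟶ B) : IsIso (Λ.map f) ↔ IsIso (Λ'.map f) := by
  -- For monomorphisms, base change to representables turns the condition into membership of sieves
  -- in the covering system.
  have key {A B : PSh a} (m : A ⟶ B) [Mono m] : Epi (Λ.map m) ↔ Epi (Λ'.map m) := by
    rw [epi_map_iff_sieveOf, epi_map_iff_sieveOf]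
    simp only [← mem_coveringSystem_iff_epi, h]
  rw [isIso_map_iff, isIso_map_iff, key, key]

end ExactFunctors

/-! ### Local isomorphisms, separated presheaves and orthogonality to sheaves -/

section LocalIsomorphisms

variable {a : Type u} [Category.{v} a] [Preadditive a]

lemma GTop.mem_of_le (T : GTop a) {X : a} {R S : AddSieve X} (hR : R ∈ T.1 X)
    (h : ∀ (Y : a) (f : Y ⟶ X), f ∈ R.arrows Y → f ∈ S.arrows Y) : S ∈ T.1 X := by
  refine T.2.local_mem R S hR fun Y f hf => ?_
  convert T.2.maximal_mem Y
  rw [AddSieve.ext_iff_mem]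
  exact fun Z g => ⟨fun _ => trivial, fun _ => S.comp_mem g (h Y f hf)⟩

lemma GTop.mem_of_inter_le (T : GTop a) {X : a} {R S Q : AddSieve X} (hR : R ∈ T.1 X)
    (hS : S ∈ T.1 X)
    (h : ∀ (Y : a) (f : Y ⟶ X), f ∈ R.arrows Y → f ∈ S.arrows Y → f ∈ Q.arrows Y) :
    Q ∈ T.1 X :=
  T.2.local_mem R Q hR fun _ f hf => T.mem_of_le (T.2.pullback_mem f S hS) fun _ g hg =>
    h _ _ (R.comp_mem g hf) hg

/-- The sieve of those `g` for which `g^* x = 0`. -/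
abbrev annihilator {F : PSh a} {X : a} (x : F.obj.obj (op X)) : AddSieve X :=
  sieveOf (0 : F ⟶ F) x

lemma mem_annihilator {F : PSh a} {X Z : a} {x : F.obj.obj (op X)} {g : Z ⟶ X} :
    g ∈ (annihilator x).arrows Z ↔ F.obj.map g.op x = 0 := by
  rw [mem_sieveOf]
  exact ⟨fun ⟨y, hy⟩ => hy.symm, fun h => ⟨0, h.symm⟩⟩

/-- A morphism of presheaves is a local isomorphism if its kernel and its cokernel are locally
zero. -/
structure IsLocalIso (T : GTop a) {A B : PSh a} (f : A ⟶ B) : Prop where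
  annihilator_mem (X : a) (x : A.obj.obj (op X)) (hx : f.hom.app (op X) x = 0) :
    annihilator x ∈ T.1 X
  sieveOf_mem (X : a) (y : B.obj.obj (op X)) : sieveOf f y ∈ T.1 X

/-- A presheaf is separated if its locally zero elements are zero. -/
def IsSeparated (T : GTop a) (F : PSh a) : Prop :=
  ∀ (X : a) (x : F.obj.obj (op X)), annihilator x ∈ T.1 X → x = 0

lemma IsLocalIso.comp {T : GTop a} {A B D : PSh a} {f : A ⟶ B} {g : B ⟶ D} (hf : IsLocalIso T f)
    (hg : IsLocalIso T g) : IsLocalIso T (f ≫ g) where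
  annihilator_mem X x hx := by
    refine T.2.local_mem _ _ (hg.annihilator_mem X (f.hom.app (op X) x) hx) fun Y k hk => ?_
    rw [mem_annihilator, ← map_app] at hk
    rw [pullback_sieveOf]
    exact hf.annihilator_mem _ _ hk
  sieveOf_mem X z := by
    refine T.2.local_mem _ _ (hg.sieveOf_mem X z) fun Y k hk => ?_
    obtain ⟨y, hy⟩ := mem_sieveOf.1 hk
    refine T.mem_of_le (hf.sieveOf_mem Y y) fun Z l hl => ?_
    obtain ⟨x, hx⟩ := mem_sieveOf.1 hl
    rw [pullback_sieveOf, mem_sieveOf]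
    exact ⟨x, by rw [comp_app, hx, map_app, hy]⟩

lemma IsLocalIso.of_comp {T : GTop a} {A B D : PSh a} {f : A ⟶ B} {g : B ⟶ D}
    (hg : IsLocalIso T g) (hfg : IsLocalIso T (f ≫ g)) : IsLocalIso T f where
  annihilator_mem X x hx := hfg.annihilator_mem X x (by rw [comp_app, hx, map_zero])
  sieveOf_mem X y := by
    refine T.2.local_mem _ _ (hfg.sieveOf_mem X (g.hom.app (op X) y)) fun Y k hk => ?_
    obtain ⟨x, hx⟩ := mem_sieveOf.1 hk
    -- The difference of `f x` and the restriction of `y` along `k` is killed by `g`, hence locally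
    -- zero; wherever it vanishes, `y` comes from `A`.
    rw [comp_app, ← map_app, ← sub_eq_zero, ← map_sub] at hx
    refine T.mem_of_le (hg.annihilator_mem Y _ hx) fun Z l hl => ?_
    rw [mem_annihilator, map_sub, sub_eq_zero, ← map_app] at hl
    rw [pullback_sieveOf, mem_sieveOf]
    exact ⟨_, hl⟩

/-- The elements of `B` that are locally in the image of `m`. -/
def closure (T : GTop a) {A B : PSh a} (m : A ⟶ B) (X : a) : AddSubgroup (B.obj.obj (op X)) where
  carrier := {y | sieveOf m y ∈ T.1 X}
  zero_mem' := T.mem_of_le (T.2.maximal_mem X) fun Z g _ => mem_sieveOf.2 ⟨0, by simp⟩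
  add_mem' {y y'} hy hy' := T.mem_of_inter_le hy hy' fun Z g hg hg' => by
    obtain ⟨x, hx⟩ := mem_sieveOf.1 hg
    obtain ⟨x', hx'⟩ := mem_sieveOf.1 hg'
    exact mem_sieveOf.2 ⟨x + x', by rw [map_add, map_add, hx, hx']⟩
  neg_mem' {y} hy := T.mem_of_le hy fun Z g hg => by
    obtain ⟨x, hx⟩ := mem_sieveOf.1 hg
    exact mem_sieveOf.2 ⟨-x, by rw [map_neg, map_neg, hx]⟩

/-- The quotient of `B` by the closure of the image of `m : A ⟶ B`. -/
def closureQuotient (T : GTop a) {A B : PSh a} (m : A ⟶ B) : PSh a :=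
  ⟨{ obj X := AddCommGrpCat.of (B.obj.obj X ⧸ closure T m X.unop)
     map {X Y} g := AddCommGrpCat.ofHom (QuotientAddGroup.map _ _ (B.obj.map g).hom fun y hy => by
       have := T.2.pullback_mem g.unop _ hy
       rwa [pullback_sieveOf] at this)
     map_id X := by
       ext y
       change ((B.obj.map (𝟙 X) y : _) : B.obj.obj X ⧸ closure T m X.unop) = _
       rw [B.obj.map_id]
       rfl
     map_comp {X Y Z} g h := by
       ext y
       change ((B.obj.map (g ≫ h) y : _) : B.obj.obj Z ⧸ closure T m Z.unop) = _
       rw [B.obj.map_comp]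
       rfl },
   ⟨fun {X Y g h} => by
      ext y
      exact congr_arg (QuotientAddGroup.mk' _) (map_add_apply B g.unop h.unop y)⟩⟩

/-- The projection to the quotient by the closure of the image of `m : A ⟶ B`. -/
def closureQuotientMap (T : GTop a) {A B : PSh a} (m : A ⟶ B) : B ⟶ closureQuotient T m :=
  ObjectProperty.homMk
    { app X := AddCommGrpCat.ofHom (QuotientAddGroup.mk' (closure T m X.unop))
      naturality _ _ _ := rfl }

lemma closureQuotientMap_surjective (T : GTop a) {A B : PSh a} (m : A ⟶ B) (X : a) :
    Function.Surjective ((closureQuotientMap T m).hom.app (op X)) :=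
  QuotientAddGroup.mk'_surjective _

lemma closureQuotientMap_eq_zero_iff (T : GTop a) {A B : PSh a} (m : A ⟶ B) {X : a}
    {y : B.obj.obj (op X)} :
    (closureQuotientMap T m).hom.app (op X) y = 0 ↔ sieveOf m y ∈ T.1 X :=
  QuotientAddGroup.eq_zero_iff y

/-- An element that is locally in the closure is in the closure, by local character. -/
lemma isSeparated_closureQuotient (T : GTop a) {A B : PSh a} (m : A ⟶ B) :
    IsSeparated T (closureQuotient T m) := by
  intro X z hz
  obtain ⟨y, rfl⟩ := closureQuotientMap_surjective T m X z
  rw [closureQuotientMap_eq_zero_iff]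
  refine T.2.local_mem _ _ hz fun Y g hg => ?_
  rw [mem_annihilator, ← map_app, closureQuotientMap_eq_zero_iff] at hg
  rwa [pullback_sieveOf]

/-- For the zero morphism the closure consists of the locally zero elements, so this is the
separated quotient of `F`. -/
lemma isLocalIso_closureQuotientMap (T : GTop a) (F : PSh a) :
    IsLocalIso T (closureQuotientMap T (0 : F ⟶ F)) where
  annihilator_mem _ _ hx := (closureQuotientMap_eq_zero_iff T _).1 hx
  sieveOf_mem X _ := T.mem_of_le (T.2.maximal_mem X) fun _ _ _ =>
    mem_sieveOf.2 (closureQuotientMap_surjective _ _ _ _)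

lemma isSeparated_of_isSheaf {T : GTop a} {F : PSh a} (hF : isSheaf T F) : IsSeparated T F := by
  intro X x hx
  apply ofElement_injective
  apply (hF _ (coverings.mk _ hx)).1
  refine hom_ext_apply fun Y g => ?_
  have h1 : F.obj.map g.1.op x = 0 := mem_annihilator.1 g.2
  exact h1.trans (map_zero (F.obj.map g.1.op).hom).symm

lemma IsSeparated.eq_zero {T : GTop a} {F : PSh a} (hF : IsSeparated T F) {X : a}
    {R : AddSieve X} (hR : R ∈ T.1 X) (x : F.obj.obj (op X))
    (hx : ∀ (Y : a) (g : Y ⟶ X), g ∈ R.arrows Y → F.obj.map g.op x = 0) : x = 0 :=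
  hF X x (T.mem_of_le hR fun Y g hg => mem_annihilator.2 (hx Y g hg))

lemma IsSeparated.ext {T : GTop a} {F : PSh a} (hF : IsSeparated T F) {X : a}
    {R : AddSieve X} (hR : R ∈ T.1 X) (x y : F.obj.obj (op X))
    (hx : ∀ (Y : a) (g : Y ⟶ X), g ∈ R.arrows Y → F.obj.map g.op x = F.obj.map g.op y) :
    x = y := by
  rw [← sub_eq_zero]
  refine hF.eq_zero hR _ fun Y g hg => ?_
  rw [map_sub, hx Y g hg, sub_self]

lemma exists_glue_of_isSheaf {T : GTop a} {F : PSh a} (hF : isSheaf T F) {X : a} {R : AddSieve X}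
    (hR : R ∈ T.1 X) (k : R.toPSh ⟶ F) : ∃ x : F.obj.obj (op X),
      ∀ (Y : a) (g : R.toPSh.obj.obj (op Y)), F.obj.map g.1.op x = k.hom.app (op Y) g := by
  obtain ⟨m, hm⟩ := (hF _ (coverings.mk _ hR)).2 k
  refine ⟨m.hom.app (op X) (𝟙 X), fun Y g => ?_⟩
  rw [← hm]
  refine Eq.trans ?_ (congr_arg (fun m => m.hom.app (op Y) g.1) (eq_ofElement m)).symm
  rfl

/-- Sheaves are orthogonal to local isomorphisms. -/
lemma IsLocalIso.bijective {T : GTop a} {A B F : PSh a} {f : A ⟶ B} (hf : IsLocalIso T f)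
    (hF : isSheaf T F) : Function.Bijective (fun h : B ⟶ F => f ≫ h) := by
  have sep := isSeparated_of_isSheaf hF
  constructor
  · intro h h' hh
    refine hom_ext_apply fun X y => sep.ext (hf.sieveOf_mem X y) _ _ fun Y g hg => ?_
    obtain ⟨x, hx⟩ := mem_sieveOf.1 hg
    rw [← map_app, ← map_app, ← hx]
    exact congr_arg (fun m => m.hom.app (op Y) x) hh
  · intro k
    -- The kernel of `f` is locally zero and `F` is separated, so `k` is constant on the fibres of
    -- `f`.
    have kwd {X : a} (x x' : A.obj.obj (op X)) (hx : f.hom.app (op X) x = f.hom.app (op X) x') :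
        k.hom.app (op X) x = k.hom.app (op X) x' := by
      rw [← sub_eq_zero, ← map_sub]
      refine sep.eq_zero (hf.annihilator_mem X (x - x') (by rw [map_sub, hx, sub_self])) _
        fun Y g hg => ?_
      rw [← map_app, mem_annihilator.1 hg, map_zero]
    -- The value at `y` is glued from the values of `k` at local preimages of `y`. The condition is
    -- stated for all preimages, so that additivity and naturality of the chosen values follow by
    -- separatedness.
    have key (X : a) (y : B.obj.obj (op X)) : ∃ z : F.obj.obj (op X), ∀ (Y : a) (g : Y ⟶ X)
        (x : A.obj.obj (op Y)), f.hom.app (op Y) x = B.obj.map g.op y →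
          F.obj.map g.op z = k.hom.app (op Y) x := by
      have hc (Y : a) (g : (sieveOf f y).toPSh.obj.obj (op Y)) :
        ∃ x, f.hom.app (op Y) x = B.obj.map g.1.op y := mem_sieveOf.1 g.2
      choose c hc using hc
      let k' : (sieveOf f y).toPSh ⟶ F := ObjectProperty.homMk
        { app Y := AddCommGrpCat.ofHom (AddMonoidHom.mk' (fun g => k.hom.app Y (c Y.unop g))
            fun g g' => by
              rw [← map_add]
              refine kwd _ _ ?_
              rw [map_add]
              refine (hc _ _).trans ((map_add_apply B g.1 g'.1 y).trans ?_)
              exact congr_arg₂ _ (hc _ _).symm (hc _ _).symm)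
          naturality Y Z l := by
            ext g
            refine Eq.trans ?_ (map_app k l.unop (c Y.unop g))
            refine kwd _ _ ?_
            refine (hc _ _).trans (Eq.trans ?_ (map_app f l.unop (c Y.unop g)).symm)
            exact (map_map B g.1 l.unop y).symm.trans (congr_arg _ (hc _ _).symm) }
      obtain ⟨z, hz⟩ := exists_glue_of_isSheaf hF (hf.sieveOf_mem X y) k'
      refine ⟨z, fun Y g x hx => (hz Y ⟨g, mem_sieveOf.2 ⟨x, hx⟩⟩).trans ?_⟩
      exact kwd _ _ ((hc _ _).trans hx.symm)
    choose h hh using key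
    refine ⟨ObjectProperty.homMk
      { app X := AddCommGrpCat.ofHom (AddMonoidHom.mk' (h X.unop) fun y y' => ?_)
        naturality X Y l := ?_ }, hom_ext_apply fun X x => ?_⟩
    -- Both sides are compared where `y` and `y'` have preimages simultaneously, which takes two
    -- successive covering sieves.
    · refine sep.ext (hf.sieveOf_mem _ y) _ _ fun Y g hg => ?_
      refine sep.ext (T.2.pullback_mem g _ (hf.sieveOf_mem _ y')) _ _ fun Z l hl => ?_
      obtain ⟨x, hx⟩ := mem_sieveOf.1 ((sieveOf f y).comp_mem l hg)
      obtain ⟨x', hx'⟩ := mem_sieveOf.1 (AddSieve.mem_pullback.1 hl)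
      rw [map_map, map_map, map_add, hh _ y _ _ _ hx, hh _ y' _ _ _ hx', ← map_add]
      exact hh _ _ _ _ _ (by rw [map_add, map_add, hx, hx'])
    · ext y
      refine sep.ext (hf.sieveOf_mem _ (B.obj.map l y)) _ _ fun Z g hg => ?_
      obtain ⟨x, hx⟩ := mem_sieveOf.1 hg
      refine (hh _ _ _ g x hx).trans ?_
      refine ((map_map F l.unop g (h X.unop y)).trans (hh _ _ _ _ x ?_)).symm
      exact hx.trans (map_map B l.unop g y)
    · have := hh X (f.hom.app (op X) x) X (𝟙 X) x (map_id_apply _ _).symm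
      rwa [map_id_apply] at this

end LocalIsomorphisms

/-! ### Construction of the associated sheaf -/

section Sheafification

variable {a : Type u} [Category.{v} a] [Preadditive a]

instance : PreservesFiniteLimits (additiveFunctor aᵒᵖ AddCommGrpCat.{v}).ι :=
  PreservesLimitsOfSize.preservesFiniteLimits _

/-- Exactness of coproducts is inherited from abelian groups. -/
lemma mono_sigmaMap {I : Type v} {F G : I → PSh a} (m : ∀ i, F i ⟶ G i) [∀ i, Mono (m i)] :
    Mono (Limits.Sigma.map m) := by
  have : HasExactColimitsOfShape (Discrete I) (PSh a) :=
    HasExactColimitsOfShape.domain_of_functor (Discrete I)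
      (additiveFunctor aᵒᵖ AddCommGrpCat.{v}).ι
  have := this.preservesFiniteLimits
  have : (colim (J := Discrete I) (C := PSh a)).PreservesMonomorphisms :=
    preservesMonomorphisms_of_preservesLimitsOfShape _
  exact MorphismProperty.colimMap (W := MorphismProperty.monomorphisms (PSh a))
    (Discrete.natTrans fun i => m i.as : Discrete.functor F ⟶ Discrete.functor G)
    fun i => inferInstanceAs (Mono (m i.as))

/-- Local surjectivity becomes the vanishing of a morphism, which can be checked on any family of
morphisms that generates `B`. -/
lemma isLocalIso_of_closureQuotientMap_eq_zero {T : GTop a} {A B : PSh a} (m : A ⟶ B) [Mono m]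
    (h : closureQuotientMap T m = 0) : IsLocalIso T m where
  annihilator_mem X x hx := by
    obtain rfl : x = 0 := (mono_iff_injective m).1 inferInstance X (hx.trans (map_zero _).symm)
    exact T.mem_of_le (T.2.maximal_mem X) fun Y g _ => mem_annihilator.2 (map_zero _)
  sieveOf_mem X y := by
    rw [← closureQuotientMap_eq_zero_iff, h, zero_app]

variable [EssentiallySmall.{v} a]

lemma isSheaf_of_glue {T : GTop a} {F : PSh a} (hF : IsSeparated T F)
    (h : ∀ (Z : SmallModel.{v} a) (R : AddSieve (ofModel Z)), R ∈ T.1 (ofModel Z) →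
      ∀ k : R.toPSh ⟶ F, ∃ x : F.obj.obj (op (ofModel Z)), ∀ (Y : a)
        (g : R.toPSh.obj.obj (op Y)), F.obj.map g.1.op x = k.hom.app (op Y) g) :
    isSheaf T F := by
  rw [isSheaf_eq]
  rintro _ _ _ ⟨⟨Z, R, hR⟩⟩
  constructor
  · intro m n hmn
    change R.incl ≫ m = R.incl ≫ n at hmn
    rw [eq_ofElement m, eq_ofElement n] at hmn ⊢
    congr 1
    exact hF.ext hR _ _ fun Y g hg =>
      congr_arg (fun m => m.hom.app (op Y) (⟨g, hg⟩ : R.arrows Y)) hmn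
  · intro k
    obtain ⟨x, hx⟩ := h Z R hR k
    exact ⟨ofElement x, hom_ext_apply hx⟩

/-- Every separated presheaf `F` has a local isomorphism to a presheaf to which all morphisms from
covering sieves to `F` extend. -/
lemma exists_isLocalIso_extending (T : GTop a) (F : PSh a) :
    ∃ (J : PSh a) (j : F ⟶ J), IsLocalIso T j ∧
      ∀ (Z : SmallModel.{v} a) (R : AddSieve (ofModel Z)), R ∈ T.1 (ofModel Z) →
        ∀ k : R.toPSh ⟶ F, ∃ l : (yonedaPSh a).obj (ofModel Z) ⟶ J, R.incl ≫ l = k ≫ j := by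
  -- All gluing problems in `F` over the small model. The pushout `J` below freely adjoins a
  -- solution to each of them.
  let K := Σ Z : SmallModel.{v} a, Σ R : {R : AddSieve (ofModel Z) // R ∈ T.1 (ofModel Z)},
    (R.1.toPSh ⟶ F)
  let r (i : Shrink.{v} K) : K := (equivShrink K).symm i
  let m := Limits.Sigma.map fun i : Shrink.{v} K => (r i).2.1.1.incl
  let t : (∐ fun i : Shrink.{v} K => (r i).2.1.1.toPSh) ⟶ F := Sigma.desc fun i => (r i).2.2
  have : Mono m := mono_sigmaMap _
  have hl (i : Shrink.{v} K) : (r i).2.1.1.incl ≫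
      Sigma.ι (fun i : Shrink.{v} K => (yonedaPSh a).obj (ofModel (r i).1)) i ≫ pushout.inr t m =
      (r i).2.2 ≫ pushout.inl t m := by
    have h1 : Sigma.ι (fun i : Shrink.{v} K => (r i).2.1.1.toPSh) i ≫ m =
      (r i).2.1.1.incl ≫ Sigma.ι (fun i : Shrink.{v} K => (yonedaPSh a).obj (ofModel (r i).1)) i :=
      Sigma.ι_map _ _
    have h2 : Sigma.ι _ i ≫ t = (r i).2.2 := Sigma.ι_desc _ _
    rw [← Category.assoc, ← h1, Category.assoc, ← pushout.condition, ← Category.assoc, h2]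
  -- A pushout of the monomorphism `m` is a monomorphism, so only local surjectivity remains. An
  -- adjoined solution comes from `F` after restriction to the sieve of its gluing problem.
  refine ⟨pushout t m, pushout.inl t m, isLocalIso_of_closureQuotientMap_eq_zero _ ?_, ?_⟩
  · refine pushout.hom_ext (hom_ext_apply fun X x => ?_) (Sigma.hom_ext _ _ fun i => ?_)
    · rw [comp_app, comp_zero, zero_app, closureQuotientMap_eq_zero_iff]
      exact T.mem_of_le (T.2.maximal_mem X) fun Y g _ => mem_sieveOf.2 ⟨_, map_app _ g x⟩
    · rw [comp_zero, comp_zero, ← Category.assoc]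
      refine hom_ext_apply fun Y g => ?_
      rw [comp_app, zero_app, closureQuotientMap_eq_zero_iff]
      refine T.mem_of_le (T.2.pullback_mem g _ (r i).2.1.2) fun Z l hgl => ?_
      refine mem_sieveOf.2 ⟨(r i).2.2.hom.app (op Z) ⟨l ≫ g, hgl⟩, ?_⟩
      refine (congr_arg (fun k => k.hom.app (op Z) (⟨l ≫ g, hgl⟩ : (r i).2.1.1.arrows Z))
        (hl i).symm).trans (map_app (_ ≫ pushout.inr t m) l g)
  · intro Z R hR k
    have hi : r (equivShrink K ⟨Z, ⟨R, hR⟩, k⟩) = ⟨Z, ⟨R, hR⟩, k⟩ := Equiv.symm_apply_apply _ _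
    have := hl (equivShrink K ⟨Z, ⟨R, hR⟩, k⟩)
    have key (s : K) (h : ∃ l : (yonedaPSh a).obj (ofModel s.1) ⟶ pushout t m,
      s.2.1.1.incl ≫ l = s.2.2 ≫ pushout.inl t m) (s' : K) (hs : s = s') :
      ∃ l : (yonedaPSh a).obj (ofModel s'.1) ⟶ pushout t m,
        s'.2.1.1.incl ≫ l = s'.2.2 ≫ pushout.inl t m := hs ▸ h
    exact key _ ⟨_, this⟩ _ hi

/-- Every presheaf has a local isomorphism to a sheaf. -/
lemma exists_isLocalIso_isSheaf (T : GTop a) (F : PSh a) :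
    ∃ (S : PSh a) (m : F ⟶ S), isSheaf T S ∧ IsLocalIso T m := by
  -- Make `F` separated, adjoin solutions once, and make the result separated again. This is already
  -- a sheaf, since a gluing problem in it comes from `F₁` on a finer covering sieve.
  let F₁ := closureQuotient T (0 : F ⟶ F)
  have sep₁ : IsSeparated T F₁ := isSeparated_closureQuotient T _
  obtain ⟨J, j, hj, ext⟩ := exists_isLocalIso_extending T F₁
  let q := closureQuotientMap T (0 : J ⟶ J)
  have hq : IsLocalIso T q := isLocalIso_closureQuotientMap T J
  have sep : IsSeparated T (closureQuotient T (0 : J ⟶ J)) := isSeparated_closureQuotient T _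
  have hjq := hj.comp hq
  have inj (X : a) : Function.Injective ((j ≫ q).hom.app (op X)) :=
    (injective_iff_map_eq_zero _).2 fun x hx => sep₁ _ _ (hjq.annihilator_mem X x hx)
  refine ⟨_, closureQuotientMap T (0 : F ⟶ F) ≫ j ≫ q, isSheaf_of_glue sep fun Z R hR k => ?_,
    (isLocalIso_closureQuotientMap T F).comp hjq⟩
  -- The members of `R` whose value under `k` comes from `F₁`. They form a covering sieve because `j
  -- ≫ q` is a local isomorphism, and `k` lifts to `F₁` on it because `j ≫ q` is injective.
  let R' : AddSieve (ofModel Z) :=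
    { arrows Y := ((k.hom.app (op Y)).hom.range ⊓ ((j ≫ q).hom.app (op Y)).hom.range).comap
        (k.hom.app (op Y)).hom |>.map (R.arrows Y).subtype
      comp_mem {Y W} g f := by
        rintro ⟨f, ⟨-, x, hx⟩, rfl⟩
        refine ⟨R.toPSh.obj.map g.op f, ⟨⟨_, rfl⟩, F₁.obj.map g.op x, ?_⟩, rfl⟩
        exact (map_app (j ≫ q) g x).trans ((congr_arg _ hx).trans (map_app k g f).symm) }
  have hR'le {Y : a} {g : Y ⟶ ofModel Z} (hg : g ∈ R'.arrows Y) : g ∈ R.arrows Y := by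
    obtain ⟨f, -, rfl⟩ := hg
    exact f.2
  have mem_R' {Y : a} {g : Y ⟶ ofModel Z} (hg : g ∈ R.arrows Y) :
      g ∈ R'.arrows Y ↔ ∃ x, (j ≫ q).hom.app (op Y) x = k.hom.app (op Y) (⟨g, hg⟩ : R.arrows Y) := by
    refine ⟨?_, fun ⟨x, hx⟩ => ⟨⟨g, hg⟩, ⟨⟨_, rfl⟩, x, hx⟩, rfl⟩⟩
    rintro ⟨f, ⟨-, x, hx⟩, rfl⟩
    exact ⟨x, hx⟩
  have hR' : R' ∈ T.1 _ := by
    refine T.2.local_mem R R' hR fun Y f hf => T.mem_of_le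
      (hjq.sieveOf_mem Y (k.hom.app (op Y) (⟨f, hf⟩ : R.arrows Y))) fun W g hg => ?_
    rw [AddSieve.mem_pullback, mem_R' (R.comp_mem g hf)]
    obtain ⟨x, hx⟩ := mem_sieveOf.1 hg
    exact ⟨x, hx.trans (map_app k g _).symm⟩
  obtain ⟨i, hi⟩ := exists_lift_of_injective R.incl R'.incl (incl_injective R)
    fun Y g => ⟨⟨g.1, hR'le g.2⟩, rfl⟩
  obtain ⟨k', hk'⟩ := exists_lift_of_injective (j ≫ q) (i ≫ k) inj fun Y g => by
    obtain ⟨x, hx⟩ := (mem_R' (hR'le g.2)).1 g.2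
    refine ⟨x, hx.trans ?_⟩
    rw [comp_app]
    congr 1
    exact Subtype.ext (congr_arg (fun m => m.hom.app (op Y) g) hi).symm
  obtain ⟨l, hl⟩ := ext Z R' hR' k'
  refine ⟨(l ≫ q).hom.app _ (𝟙 (ofModel Z)), fun Y g => ?_⟩
  -- The solution is built to agree with `k` on `R'`; separatedness extends the agreement to `R`.
  refine sep.ext (T.2.pullback_mem g.1 R' hR') _ _ fun W h hh => ?_
  have hRi : R'.incl ≫ l ≫ q = i ≫ k := by rw [← hk', ← Category.assoc, hl, Category.assoc]
  have h1 := congr_arg (fun m => m.hom.app (op W) (⟨h ≫ g.1, hh⟩ : R'.arrows W)) hRi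
  have h2 := congr_arg (fun m => m.hom.app (op W) (⟨h ≫ g.1, hh⟩ : R'.arrows W)) hi
  rw [map_map, ← map_app k]
  refine Eq.trans ?_ (h1.trans ?_)
  · rw [eq_ofElement (l ≫ q)]
    simp only [ofElement_app]
    rw [map_id_apply]
    rfl
  · exact congr_arg (k.hom.app (op W)) (Subtype.ext h2)

end Sheafification

/-! ### Exactness of sheafification -/

section SheafificationExact

variable {a : Type u} [Category.{v} a] [Preadditive a]

lemma isLocalIso_of_isIso (T : GTop a) {A B : PSh a} (f : A ⟶ B) [IsIso f] : IsLocalIso T f where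
  annihilator_mem X x hx := by
    obtain rfl : x = 0 := (mono_iff_injective f).1 inferInstance X (hx.trans (map_zero _).symm)
    exact T.mem_of_le (T.2.maximal_mem X) fun Y g _ => mem_annihilator.2 (map_zero _)
  sieveOf_mem X y := T.mem_of_le (T.2.maximal_mem X) fun Y g _ =>
    mem_sieveOf.2 ((epi_iff_surjective f).1 inferInstance _ _)

/-- Elements of a separated presheaf that are locally in a subsheaf belong to it. -/
lemma exists_of_sieveOf_mem {T : GTop a} {F G : PSh a} (hF : isSheaf T F) (hG : IsSeparated T G)
    (m : F ⟶ G) (hm : ∀ X : a, Function.Injective (m.hom.app (op X))) {X : a} (y : G.obj.obj (op X))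
    (hy : sieveOf m y ∈ T.1 X) : ∃ x, m.hom.app (op X) x = y := by
  obtain ⟨l, hl⟩ := exists_lift_of_injective m ((sieveOf m y).incl ≫ ofElement y) hm
    fun Y g => mem_sieveOf.1 g.2
  obtain ⟨x, hx⟩ := exists_glue_of_isSheaf hF hy l
  refine ⟨x, hG.ext hy _ _ fun Y g hg => ?_⟩
  rw [← map_app]
  refine (congr_arg (m.hom.app (op Y)) (hx Y ⟨g, hg⟩)).trans ?_
  exact congr_arg (fun n => n.hom.app (op Y) (⟨g, hg⟩ : (sieveOf m y).arrows Y)) hl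

variable [EssentiallySmall.{v} a] (T : GTop a)

/-- The canonical morphism from a presheaf to its sheafification. -/
def toSheafify (F : PSh a) : F ⟶ ((sheafify T).obj F).obj := (sheafifyAdj T).unit.app F

lemma toSheafify_naturality {A B : PSh a} (f : A ⟶ B) :
    f ≫ toSheafify T B = toSheafify T A ≫ ((sheafify T).map f).hom :=
  (sheafifyAdj T).unit.naturality f

lemma toSheafify_hom_ext {F : PSh a} {S : Sh T} {f g : (sheafify T).obj F ⟶ S}
    (h : toSheafify T F ≫ f.hom = toSheafify T F ≫ g.hom) : f = g := by
  apply ((sheafifyAdj T).homEquiv F S).injective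
  rw [Adjunction.homEquiv_unit, Adjunction.homEquiv_unit]
  exact h

/-- Sheafification is given only as an abstract adjoint. A local isomorphism to a sheaf is also
universal, by orthogonality, so it differs from the unit by an isomorphism. -/
lemma isLocalIso_toSheafify (F : PSh a) : IsLocalIso T (toSheafify T F) := by
  obtain ⟨S, m, hS, hm⟩ := exists_isLocalIso_isSheaf T F
  obtain ⟨h, hh : m ≫ h = toSheafify T F⟩ :=
    (hm.bijective ((sheafify T).obj F).property).2 (toSheafify T F)
  let n : (sheafify T).obj F ⟶ ⟨S, hS⟩ := ((sheafifyAdj T).homEquiv F ⟨S, hS⟩).symm m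
  have hn : toSheafify T F ≫ n.hom = m := by
    have := ((sheafifyAdj T).homEquiv F ⟨S, hS⟩).apply_symm_apply m
    rwa [Adjunction.homEquiv_unit] at this
  have h1 : h ≫ n.hom = 𝟙 S := (hm.bijective hS).1 (by
    change m ≫ h ≫ n.hom = m ≫ 𝟙 _
    rw [← Category.assoc, hh, hn, Category.comp_id])
  have h2 : n ≫ ObjectProperty.homMk h = 𝟙 _ := toSheafify_hom_ext T (by
    change toSheafify T F ≫ n.hom ≫ h = _ ≫ 𝟙 _
    rw [← Category.assoc, hn, hh, Category.comp_id])
  have : IsIso h := ⟨n.hom, h1, congr_arg (·.hom) h2⟩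
  rw [← hh]
  exact hm.comp (isLocalIso_of_isIso T h)

/-- Sheafification inverts precisely the local isomorphisms. -/
lemma isIso_sheafify_map_iff {A B : PSh a} (f : A ⟶ B) :
    IsIso ((sheafify T).map f) ↔ IsLocalIso T f := by
  constructor
  · intro _
    -- Cancellation in the naturality square of the unit, whose vertical morphisms are local
    -- isomorphisms.
    refine (isLocalIso_toSheafify T B).of_comp ?_
    rw [toSheafify_naturality]
    exact (isLocalIso_toSheafify T A).comp
      (isLocalIso_of_isIso T ((isSheaf T).ι.map ((sheafify T).map f)))
  · intro h
    rw [← ObjectProperty.isLocal_iff_isIso_map (sheafifyAdj T)]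
    rintro _ ⟨S, rfl⟩
    exact h.bijective S.property

instance : PreservesColimitsOfSize.{v, v} (sheafify T) :=
  (sheafifyAdj T).leftAdjoint_preservesColimits

instance : HasZeroObject (Sh T) := hasZeroObject_of_hasTerminal_object

/-- That sheaves form an abelian category is only deduced from this, so kernels are treated
directly. Injectivity of the sheafified kernel inclusion, and the lifting of elements killed by the
sheafified `f`, both hold locally because the units are local isomorphisms; the sheaf conditions
make them hold globally. -/
instance : PreservesFiniteLimits (sheafify T) := by
  have (A B : PSh a) (f : A ⟶ B) : PreservesLimit (parallelPair f 0) (sheafify T) := by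
    let k := kernel.ι f
    let Lk := (sheafify T).map k
    let Lf := (sheafify T).map f
    let η := toSheafify T
    have hL {A B : PSh a} (f : A ⟶ B) {X : a} (x : A.obj.obj (op X)) :
        ((sheafify T).map f).hom.hom.app (op X) ((η A).hom.app (op X) x) =
          (η B).hom.app (op X) (f.hom.app (op X) x) :=
      congr_arg (fun m => m.hom.app (op X) x) (toSheafify_naturality T f).symm
    have sep (F : PSh a) : IsSeparated T ((sheafify T).obj F).obj :=
      isSeparated_of_isSheaf ((sheafify T).obj F).property
    have hk (X : a) : Function.Injective (k.hom.app (op X)) :=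
      (mono_iff_injective k).1 inferInstance X
    have inj (X : a) : Function.Injective (Lk.hom.hom.app (op X)) := by
      refine (injective_iff_map_eq_zero _).2 fun x hx => ?_
      refine (sep _).eq_zero ((isLocalIso_toSheafify T _).sieveOf_mem X x) x fun Y g hg => ?_
      obtain ⟨y, hy⟩ := mem_sieveOf.1 hg
      rw [← hy]
      refine (sep _).eq_zero ((isLocalIso_toSheafify T _).annihilator_mem Y (k.hom.app (op Y) y) ?_) _
        fun Z h hh => ?_
      · refine (hL k y).symm.trans ((congr_arg _ hy).trans ?_)
        refine (map_app Lk.hom g x).trans ?_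
        rw [hx, map_zero]
      · rw [mem_annihilator, ← map_app] at hh
        rw [← map_app, hk _ (hh.trans (map_zero _).symm), map_zero]
    have w : Lk ≫ Lf = 0 := by
      rw [← Functor.map_comp, kernel.condition, Functor.map_zero]
    have hex (X : a) (y : ((sheafify T).obj A).obj.obj.obj (op X))
        (hy : Lf.hom.hom.app (op X) y = 0) : ∃ x, Lk.hom.hom.app (op X) x = y := by
      refine exists_of_sieveOf_mem ((sheafify T).obj _).property (sep _) Lk.hom inj y ?_
      refine T.2.local_mem _ _ ((isLocalIso_toSheafify T _).sieveOf_mem X y) fun Y g hg => ?_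
      obtain ⟨x, hx⟩ := mem_sieveOf.1 hg
      have hfx : (η B).hom.app (op Y) (f.hom.app (op Y) x) = 0 := by
        refine (hL f x).symm.trans ((congr_arg _ hx).trans ?_)
        refine (map_app Lf.hom g y).trans ?_
        rw [hy, map_zero]
      refine T.mem_of_le ((isLocalIso_toSheafify T _).annihilator_mem Y _ hfx) fun Z h hh => ?_
      rw [mem_annihilator, ← map_app] at hh
      obtain ⟨z, hz⟩ := (ShortComplex.ab_exact_iff _).1
        ((ShortComplex.exact_kernel f).map (ev Z)) _ hh
      rw [pullback_sieveOf, mem_sieveOf, ← hx]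
      refine ⟨(η _).hom.app (op Z) z, (hL k z).trans ?_⟩
      exact (congr_arg _ hz).trans (map_app (η A) h x)
    obtain ⟨hlim⟩ := isKernel_of_exact Lk.hom Lf.hom (congr_arg (·.hom) w) inj hex
    refine preservesLimit_of_preserves_limit_cone (kernelIsKernel f) ?_
    refine (KernelFork.isLimitMapConeEquiv _ (sheafify T)).symm ?_
    exact isLimitOfReflects (isSheaf T).ι
      ((KernelFork.isLimitMapConeEquiv _ (isSheaf T).ι).symm hlim)
  exact (sheafify T).preservesFiniteLimits_of_preservesKernels

/-- Sheaves form an abelian category. -/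
abbrev abelianSh : Abelian (Sh T) :=
  abelianOfAdjunction (isSheaf T).ι (sheafify T) (asIso (sheafifyAdj T).counit) (sheafifyAdj T)

attribute [local instance] abelianSh

/-- A sieve covers for `Z` exactly if its inclusion is a local isomorphism. The sieve of the
identity under that inclusion is the sieve itself, which gives membership in `T`. -/
lemma coveringSystem_sheafYoneda : coveringSystem (sheafYoneda T) = T.1 := by
  funext X
  ext R
  refine (mem_coveringSystem_iff_epi (sheafify T)).trans ?_
  refine Iff.trans (b := IsIso ((sheafify T).map R.incl))
    ⟨fun _ => isIso_of_mono_of_epi _, fun _ => inferInstance⟩ ?_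
  rw [isIso_sheafify_map_iff]
  refine ⟨fun h => ?_, fun h => isLocalIso_of_closureQuotientMap_eq_zero _ (hom_ext_apply fun Y f => ?_)⟩
  · have := h.sieveOf_mem X (yonedaElt (𝟙 X))
    rw [sieveOf_incl] at this
    exact T.mem_of_le this fun Y f hf => by simpa using AddSieve.mem_pullback.1 hf
  · refine (closureQuotientMap_eq_zero_iff T _).2 ?_
    obtain ⟨f, rfl⟩ := yonedaElt_surjective f
    rw [sieveOf_incl]
    exact T.2.pullback_mem _ _ h

end SheafificationExact

/-! ### Restriction of presheaves along a functor and its left adjoint -/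

section Extension

variable {a : Type u} [Category.{v} a] [Preadditive a]

/-- Every presheaf is a cokernel of a morphism between coproducts of representable presheaves. -/
lemma presheaf_induction [EssentiallySmall.{v} a] (P : PSh a → Prop)
    (hcoprod : ∀ (I : Type v) (X : I → a), P (∐ fun i => (yonedaPSh a).obj (X i)))
    (hcoker : ∀ {A B F : PSh a} (r : A ⟶ B) (π : B ⟶ F) (h : r ≫ π = 0),
      IsColimit (CokernelCofork.ofπ π h) → P A → P B → P F) (F : PSh a) : P F := by
  let π := coverMap F fun _ _ => True
  let p (X : a) (y : (cover F fun _ _ => True).obj.obj (op X)) : Prop := π.hom.app (op X) y = 0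
  obtain ⟨hc⟩ := isCokernel_of_exact (coverMap _ p) π
    (coverMap_comp_eq_zero _ _ _ fun _ _ h => h) (fun X => coverMap_surjective F X.unop)
    (fun X y hy => exists_coverMap _ _ (fun X Y f y (hy : π.hom.app (op Y) y = 0) => by
      rw [map_app, hy, map_zero]) X.unop y hy)
  exact hcoker _ _ _ hc (hcoprod _ _) (hcoprod _ _)

lemma isIso_app_of_isIso_app_yoneda [EssentiallySmall.{v} a] {C : Type w} [Category.{v₁} C]
    {Λ Λ' : PSh a ⥤ C} [PreservesColimitsOfSize.{v, v} Λ] [PreservesColimitsOfSize.{v, v} Λ']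
    (α : Λ ⟶ Λ') (h : ∀ X : a, IsIso (α.app ((yonedaPSh a).obj X))) (F : PSh a) :
    IsIso (α.app F) := by
  induction F using presheaf_induction with
  | hcoprod I X =>
    have : IsIso (Functor.whiskerLeft (Discrete.functor fun i => (yonedaPSh a).obj (X i)) α) :=
      (NatTrans.isIso_iff_isIso_app _).2 fun i => h _
    exact isIso_app_coconePt_of_preservesColimit _ α (colimit.cocone _) (colimit.isColimit _)
  | hcoker r π h hc hA hB =>
    have : IsIso (Functor.whiskerLeft (parallelPair r 0) α) := by
      refine (NatTrans.isIso_iff_isIso_app _).2 ?_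
      rintro (_ | _)
      · exact hA
      · exact hB
    exact isIso_app_coconePt_of_preservesColimit _ α _ hc

lemma yonedaPSh_map_app {X Y Z : a} (f : X ⟶ Y) (g : Z ⟶ X) :
    ((yonedaPSh a).map f).hom.app (op Z) (yonedaElt g) = yonedaElt (g ≫ f) := rfl

lemma yonedaPSh_obj_map {X Y Z : a} (f : Y ⟶ X) (g : Z ⟶ Y) :
    ((yonedaPSh a).obj X).obj.map g.op (yonedaElt f) = yonedaElt (g ≫ f) := rfl

lemma yonedaPSh_hom_ext {X : a} {F : PSh a} {f g : (yonedaPSh a).obj X ⟶ F}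
    (h : f.hom.app (op X) (yonedaElt (𝟙 X)) = g.hom.app (op X) (yonedaElt (𝟙 X))) : f = g :=
  (yonedaEquivPSh F X).injective h

lemma ofElement_app_yonedaElt {F : PSh a} {X Y : a} (x : F.obj.obj (op X)) (g : Y ⟶ X) :
    (ofElement x).hom.app (op Y) (yonedaElt g) = F.obj.map g.op x := rfl

lemma ofElement_app_id {F : PSh a} {X : a} (x : F.obj.obj (op X)) :
    (ofElement x).hom.app (op X) (yonedaElt (𝟙 X)) = x := map_id_apply F x

variable {b : Type u'} [Category.{v} b] [Preadditive b] (φ : a ⥤ b) [φ.Additive]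

/-- Restriction of presheaves along an additive functor. -/
def restrict : PSh b ⥤ PSh a :=
  ObjectProperty.lift _ ((additiveFunctor bᵒᵖ AddCommGrpCat.{v}).ι ⋙
    (Functor.whiskeringLeft _ _ AddCommGrpCat.{v}).obj φ.op) fun F =>
      ⟨fun {X Y f g} => by
        have := F.property
        change F.obj.map (φ.map (f.unop + g.unop)).op = _
        rw [φ.map_add]
        exact F.property.map_add⟩

instance : PreservesColimitsOfSize.{v, v} (restrict φ) := by
  have : PreservesColimitsOfSize.{v, v} (restrict φ ⋙ (additiveFunctor aᵒᵖ AddCommGrpCat.{v}).ι) :=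
    inferInstanceAs (PreservesColimitsOfSize.{v, v}
      ((additiveFunctor bᵒᵖ AddCommGrpCat.{v}).ι ⋙
        (Functor.whiskeringLeft _ _ AddCommGrpCat.{v}).obj φ.op))
  exact preservesColimits_of_reflects_of_preserves _ (additiveFunctor aᵒᵖ AddCommGrpCat.{v}).ι

instance : PreservesLimitsOfSize.{v, v} (restrict φ) := by
  have : PreservesLimitsOfSize.{v, v} (restrict φ ⋙ (additiveFunctor aᵒᵖ AddCommGrpCat.{v}).ι) :=
    inferInstanceAs (PreservesLimitsOfSize.{v, v}
      ((additiveFunctor bᵒᵖ AddCommGrpCat.{v}).ι ⋙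
        (Functor.whiskeringLeft _ _ AddCommGrpCat.{v}).obj φ.op))
  exact preservesLimits_of_reflects_of_preserves _ (additiveFunctor aᵒᵖ AddCommGrpCat.{v}).ι

instance : PreservesFiniteLimits (restrict φ) := PreservesLimitsOfSize.preservesFiniteLimits _

variable [EssentiallySmall.{v} a]

/-- At a representable the left adjoint exists by the Yoneda lemma, with value the representable of
`φ X`. The presheaves at which it exists are closed under coproducts and cokernels. -/
instance : (restrict φ).IsRightAdjoint := by
  apply Functor.isRightAdjoint_of_leftAdjointObjIsDefined_eq_top
  refine eq_top_iff.2 fun F _ => ?_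
  induction F using presheaf_induction with
  | hcoprod I X =>
    refine Functor.leftAdjointObjIsDefined_colimit _ fun i => ?_
    rw [Functor.leftAdjointObjIsDefined_iff]
    refine Functor.CorepresentableBy.isCorepresentable (X := (yonedaPSh b).obj (φ.obj (X i.as)))
      { homEquiv {G} := (yonedaEquivPSh G _).trans
          (yonedaEquivPSh ((restrict φ).obj G) (X i.as)).symm
        homEquiv_comp {G G'} g f := ?_ }
    exact (ofElement_comp (F := (restrict φ).obj G) _ ((restrict φ).map g)).symm
  | hcoker r π h hc hA hB =>
    refine Functor.leftAdjointObjIsDefined_of_isColimit hc ?_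
    rintro (_ | _)
    · exact hA trivial
    · exact hB trivial

/-- The left adjoint of restriction along an additive functor. -/
def extend : PSh a ⥤ PSh b := (restrict φ).leftAdjoint

/-- Extension is left adjoint to restriction. -/
def extendAdj : extend φ ⊣ restrict φ := Adjunction.ofIsRightAdjoint _

instance : PreservesColimitsOfSize.{v, v} (extend φ) := (extendAdj φ).leftAdjoint_preservesColimits

/-- The canonical morphism from a presheaf to the restriction of its extension. -/
def toExtend (F : PSh a) : F ⟶ (restrict φ).obj ((extend φ).obj F) := (extendAdj φ).unit.app F

/-- The element of the extension of `F` given by an element of `F`. -/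
def extendElt {F : PSh a} {X : a} (x : F.obj.obj (op X)) :
    ((extend φ).obj F).obj.obj (op (φ.obj X)) := (toExtend φ F).hom.app (op X) x

lemma extendElt_zero {F : PSh a} {X : a} : extendElt φ (0 : F.obj.obj (op X)) = 0 :=
  map_zero ((toExtend φ F).hom.app (op X)).hom

lemma extendElt_add {F : PSh a} {X : a} (x y : F.obj.obj (op X)) :
    extendElt φ (x + y) = extendElt φ x + extendElt φ y :=
  map_add ((toExtend φ F).hom.app (op X)).hom x y

lemma extendElt_neg {F : PSh a} {X : a} (x : F.obj.obj (op X)) :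
    extendElt φ (-x) = -extendElt φ x :=
  map_neg ((toExtend φ F).hom.app (op X)).hom x

lemma extendElt_map {F : PSh a} {X Y : a} (g : Y ⟶ X) (x : F.obj.obj (op X)) :
    extendElt φ (F.obj.map g.op x) = ((extend φ).obj F).obj.map (φ.map g).op (extendElt φ x) :=
  map_app (toExtend φ F) g x

lemma map_extendElt {A B : PSh a} (f : A ⟶ B) {X : a} (x : A.obj.obj (op X)) :
    ((extend φ).map f).hom.app (op (φ.obj X)) (extendElt φ x) =
      extendElt φ (f.hom.app (op X) x) :=
  congr_arg (fun m => m.hom.app (op X) x) ((extendAdj φ).unit.naturality f).symm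

lemma extend_hom_ext {F : PSh a} {G : PSh b} {f g : (extend φ).obj F ⟶ G}
    (h : ∀ (X : a) (x : F.obj.obj (op X)),
      f.hom.app _ (extendElt φ x) = g.hom.app _ (extendElt φ x)) : f = g := by
  apply ((extendAdj φ).homEquiv F G).injective
  rw [Adjunction.homEquiv_unit, Adjunction.homEquiv_unit]
  exact hom_ext_apply h

/-- The morphism from the extension of a representable presheaf that maps `𝟙 X` to `𝟙 (φ X)`. -/
def extendYonedaHom (X : a) :
    (extend φ).obj ((yonedaPSh a).obj X) ⟶ (yonedaPSh b).obj (φ.obj X) :=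
  ((extendAdj φ).homEquiv _ _).symm
    (ofElement (F := (restrict φ).obj ((yonedaPSh b).obj (φ.obj X))) (yonedaElt (𝟙 (φ.obj X))))

lemma extendYonedaHom_extendElt {X Y : a} (g : Y ⟶ X) :
    (extendYonedaHom φ X).hom.app (op (φ.obj Y)) (extendElt φ (yonedaElt g)) =
      yonedaElt (φ.map g) := by
  have := ((extendAdj φ).homEquiv _ _).apply_symm_apply
    (ofElement (F := (restrict φ).obj ((yonedaPSh b).obj (φ.obj X))) (yonedaElt (𝟙 (φ.obj X))))
  rw [Adjunction.homEquiv_unit] at this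
  refine (congr_arg (fun m => m.hom.app (op Y) (yonedaElt g)) this).trans ?_
  exact (yonedaPSh_obj_map (𝟙 (φ.obj X)) (φ.map g)).trans (by rw [Category.comp_id])

/-- The extension of a representable presheaf is representable. -/
def extendYonedaIso (X : a) :
    (yonedaPSh b).obj (φ.obj X) ≅ (extend φ).obj ((yonedaPSh a).obj X) where
  hom := ofElement (extendElt φ (yonedaElt (𝟙 X)))
  inv := extendYonedaHom φ X
  hom_inv_id := yonedaPSh_hom_ext (by
    rw [comp_app, ofElement_app_id, extendYonedaHom_extendElt, φ.map_id]
    rfl)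
  inv_hom_id := extend_hom_ext φ fun Y g => by
    obtain ⟨g, rfl⟩ := yonedaElt_surjective g
    rw [comp_app, extendYonedaHom_extendElt, ofElement_app_yonedaElt, ← extendElt_map,
      yonedaPSh_obj_map, Category.comp_id]
    rfl

/-- Extension of presheaves extends the functor. -/
def yonedaExtendIso : yonedaPSh a ⋙ extend φ ≅ φ ⋙ yonedaPSh b :=
  Iso.symm <| NatIso.ofComponents (F := φ ⋙ yonedaPSh b) (G := yonedaPSh a ⋙ extend φ)
    (fun X => extendYonedaIso φ X) fun {X Y} f => yonedaPSh_hom_ext (a := b) (X := φ.obj X) (by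
    change (ofElement (extendElt φ (yonedaElt (𝟙 Y)))).hom.app _
        (((yonedaPSh b).map (φ.map f)).hom.app (op (φ.obj X)) (yonedaElt (𝟙 (φ.obj X)))) =
      ((extend φ).map ((yonedaPSh a).map f)).hom.app _
        ((ofElement (extendElt φ (yonedaElt (𝟙 X)))).hom.app (op (φ.obj X))
          (yonedaElt (𝟙 (φ.obj X))))
    rw [ofElement_app_id, map_extendElt, yonedaPSh_map_app, yonedaPSh_map_app,
      Category.id_comp, Category.id_comp, ofElement_app_yonedaElt, ← extendElt_map,
      yonedaPSh_obj_map, Category.comp_id])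

/-- All functors involved are cocontinuous, so representables suffice; there the unit is the action
of `φ` on morphisms. -/
instance isIso_toExtend [φ.Full] [φ.Faithful] (F : PSh a) : IsIso (toExtend φ F) := by
  refine isIso_app_of_isIso_app_yoneda (Λ := 𝟭 (PSh a)) (Λ' := extend φ ⋙ restrict φ)
    (extendAdj φ).unit (fun X => ?_) F
  change IsIso (toExtend φ ((yonedaPSh a).obj X))
  have : IsIso (toExtend φ ((yonedaPSh a).obj X) ≫
      (restrict φ).map (extendYonedaIso φ X).inv) := by
    rw [isIso_iff_bijective]
    intro Y
    have h (g : Y ⟶ X) : (toExtend φ ((yonedaPSh a).obj X) ≫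
      (restrict φ).map (extendYonedaIso φ X).inv).hom.app (op Y) (yonedaElt g) =
        yonedaElt (φ.map g) := extendYonedaHom_extendElt φ g
    constructor
    · intro g g' hg
      obtain ⟨g, rfl⟩ := yonedaElt_surjective g
      obtain ⟨g', rfl⟩ := yonedaElt_surjective g'
      rw [h, h] at hg
      exact φ.map_injective hg
    · intro g
      exact ⟨yonedaElt (φ.preimage g), (h _).trans (φ.map_preimage g)⟩
  exact IsIso.of_isIso_comp_right _ ((restrict φ).map (extendYonedaIso φ X).inv)

instance [φ.Full] [φ.Faithful] : (extend φ).Faithful :=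
  have (F : PSh a) : IsIso ((extendAdj φ).unit.app F) := isIso_toExtend φ F
  (extendAdj φ).faithful_L_of_mono_unit_app

instance [φ.Full] [φ.Faithful] : (extend φ).Full :=
  have (F : PSh a) : IsIso ((extendAdj φ).unit.app F) := isIso_toExtend φ F
  (extendAdj φ).full_L_of_isSplitEpi_unit_app

end Extension

/-! ### Subpresheaves and elements of coproducts -/

section Subpresheaves

variable {a : Type u} [Category.{v} a] [Preadditive a]

/-- The presheaf given by subgroups that are stable under restriction. -/
def subpresheaf (G : PSh a) (S : ∀ X : a, AddSubgroup (G.obj.obj (op X)))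
    (hS : ∀ {X Y : a} (g : Y ⟶ X) {x : G.obj.obj (op X)}, x ∈ S X → G.obj.map g.op x ∈ S Y) :
    PSh a :=
  ⟨{ obj X := AddCommGrpCat.of (S X.unop)
     map {X Y} g := AddCommGrpCat.ofHom
       (AddMonoidHom.mk' (fun x : S X.unop => ⟨G.obj.map g x.1, hS g.unop x.2⟩)
         fun x y => Subtype.ext (map_add (G.obj.map g).hom x.1 y.1))
     map_id X := by
       ext x
       exact map_id_apply G x.1
     map_comp g h := by
       ext x
       exact (map_map G g.unop h.unop x.1).symm },
   ⟨fun {X Y g h} => by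
      ext x
      exact map_add_apply G g.unop h.unop x.1⟩⟩

/-- The inclusion of a subpresheaf. -/
def subpresheafIncl (G : PSh a) (S : ∀ X : a, AddSubgroup (G.obj.obj (op X)))
    (hS : ∀ {X Y : a} (g : Y ⟶ X) {x : G.obj.obj (op X)}, x ∈ S X → G.obj.map g.op x ∈ S Y) :
    subpresheaf G S hS ⟶ G :=
  ObjectProperty.homMk
    { app X := AddCommGrpCat.ofHom (S X.unop).subtype
      naturality _ _ _ := rfl }

lemma subpresheafIncl_injective (G : PSh a) (S : ∀ X : a, AddSubgroup (G.obj.obj (op X)))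
    (hS : ∀ {X Y : a} (g : Y ⟶ X) {x : G.obj.obj (op X)}, x ∈ S X → G.obj.map g.op x ∈ S Y)
    (X : a) : Function.Injective ((subpresheafIncl G S hS).hom.app (op X)) :=
  Subtype.val_injective

lemma exists_subpresheafIncl (G : PSh a) (S : ∀ X : a, AddSubgroup (G.obj.obj (op X)))
    (hS : ∀ {X Y : a} (g : Y ⟶ X) {x : G.obj.obj (op X)}, x ∈ S X → G.obj.map g.op x ∈ S Y)
    {X : a} {x : G.obj.obj (op X)} : (∃ y, (subpresheafIncl G S hS).hom.app (op X) y = x) ↔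
      x ∈ S X :=
  ⟨fun ⟨y, hy⟩ => hy ▸ y.2, fun h => ⟨⟨x, h⟩, rfl⟩⟩

/-- Every element of a coproduct of presheaves is a finite sum of elements of the summands. -/
lemma exists_finset_sum {I : Type v} [DecidableEq I] (F : I → PSh a) {X : a} (x : (∐ F).obj.obj (op X)) :
    ∃ s : Finset I, x = ∑ i ∈ s, (Sigma.ι F i).hom.app (op X) ((Sigma.π F i).hom.app (op X) x) := by
  let c (s : Finset I) (X : a) (x : (∐ F).obj.obj (op X)) : (∐ F).obj.obj (op X) :=
    ∑ i ∈ s, (Sigma.ι F i).hom.app (op X) ((Sigma.π F i).hom.app (op X) x)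
  have c_map (s : Finset I) {X Y : a} (g : Y ⟶ X) (x : (∐ F).obj.obj (op X)) :
      c s Y ((∐ F).obj.map g.op x) = (∐ F).obj.map g.op (c s X x) := by
    simp only [c, map_app, map_sum]
  have c_add (s : Finset I) {X : a} (x y : (∐ F).obj.obj (op X)) :
      c s X (x + y) = c s X x + c s X y := by
    simp only [c, map_add, Finset.sum_add_distrib]
  have c_neg (s : Finset I) {X : a} (x : (∐ F).obj.obj (op X)) : c s X (-x) = -c s X x := by
    simp only [c, map_neg, Finset.sum_neg_distrib]
  -- The elements that equal their partial sums over all large finite sets; asking for all larger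
  -- sets makes this closed under addition.
  let S (X : a) : AddSubgroup ((∐ F).obj.obj (op X)) :=
    { carrier := {x | ∃ s, ∀ s', s ⊆ s' → x = c s' X x}
      zero_mem' := ⟨∅, fun s' _ => by simp [c]⟩
      add_mem' := by
        rintro x y ⟨s, hs⟩ ⟨t, ht⟩
        refine ⟨s ∪ t, fun s' h => ?_⟩
        rw [c_add, ← hs s' (Finset.union_subset_left h), ← ht s' (Finset.union_subset_right h)]
      neg_mem' := by
        rintro x ⟨s, hs⟩
        exact ⟨s, fun s' h => by rw [c_neg, ← hs s' h]⟩ }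
  have hS {X Y : a} (g : Y ⟶ X) {x : (∐ F).obj.obj (op X)} (hx : x ∈ S X) :
      (∐ F).obj.map g.op x ∈ S Y := by
    obtain ⟨s, hs⟩ := hx
    exact ⟨s, fun s' h => by rw [c_map, ← hs s' h]⟩
  have hι (i : I) : ∃ l, l ≫ subpresheafIncl _ S hS = Sigma.ι F i := by
    refine exists_lift_of_injective _ _ (subpresheafIncl_injective _ _ _) fun X x => ?_
    rw [exists_subpresheafIncl]
    refine ⟨{i}, fun s h => ?_⟩
    rw [Finset.singleton_subset_iff] at h
    simp only [c]
    rw [Finset.sum_eq_single_of_mem i h, ← comp_app (Sigma.ι F i) (Sigma.π F i),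
      Sigma.ι_π_eq_id]
    · rfl
    · intro j _ hj
      rw [← comp_app (Sigma.ι F i) (Sigma.π F j), Sigma.ι_π_of_ne _ hj.symm, zero_app, map_zero]
  choose l hl using hι
  -- All summands lie in `S`, so the identity of the coproduct factors through it.
  have hid : Sigma.desc l ≫ subpresheafIncl _ S hS = 𝟙 (∐ F) :=
    Sigma.hom_ext _ _ fun i => by rw [Sigma.ι_desc_assoc, hl, Category.comp_id]
  have hx : x ∈ S X := (exists_subpresheafIncl _ S hS).1
    ⟨(Sigma.desc l).hom.app (op X) x, congr_arg (fun m => m.hom.app (op X) x) hid⟩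
  obtain ⟨s, hs⟩ := hx
  exact ⟨s, hs s subset_rfl⟩

end Subpresheaves

/-! ### Flat functors have exact extensions -/

section Flatness

variable {a : Type u} [Category.{v} a] [Preadditive a]
  {b : Type u'} [Category.{v} b] [Preadditive b]

/-- A flatness condition for an additive functor: the category of morphisms from an object to
values of the functor is cofiltered, in the additive sense. -/
structure IsFlat (φ : a ⥤ b) : Prop where
  nonempty : Nonempty a
  exists_pair {d : b} {X X' : a} (h : d ⟶ φ.obj X) (h' : d ⟶ φ.obj X') :
    ∃ (Y : a) (p : Y ⟶ X) (p' : Y ⟶ X') (l : d ⟶ φ.obj Y), l ≫ φ.map p = h ∧ l ≫ φ.map p' = h'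
  exists_kernel {d : b} {X X' : a} (k : X ⟶ X') (h : d ⟶ φ.obj X) (w : h ≫ φ.map k = 0) :
    ∃ (K : a) (i : K ⟶ X) (h' : d ⟶ φ.obj K), i ≫ k = 0 ∧ h' ≫ φ.map i = h

lemma IsFlat.exists_finset_kernel {φ : a ⥤ b} [φ.Additive] (hφ : IsFlat φ) {I : Type*} (s : Finset I)
    {d : b} {X : a} {X' : I → a} (k : ∀ i, X ⟶ X' i) (h : d ⟶ φ.obj X)
    (w : ∀ i, h ≫ φ.map (k i) = 0) :
    ∃ (K : a) (i : K ⟶ X) (h' : d ⟶ φ.obj K), (∀ j ∈ s, i ≫ k j = 0) ∧ h' ≫ φ.map i = h := by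
  classical
  induction s using Finset.induction_on with
  | empty => exact ⟨X, 𝟙 X, h, by simp⟩
  | insert j s _ ih =>
    obtain ⟨K, i, h', hi, hh⟩ := ih
    obtain ⟨K', i', h'', hi', hh'⟩ := hφ.exists_kernel (i ≫ k j) h' (by
      rw [φ.map_comp, ← Category.assoc, hh, w])
    refine ⟨K', i' ≫ i, h'', fun l hl => ?_, by rw [φ.map_comp, ← Category.assoc, hh', hh]⟩
    rw [Category.assoc]
    obtain rfl | hl := Finset.mem_insert.1 hl
    · exact hi'
    · rw [hi l hl, comp_zero]

variable [EssentiallySmall.{v} a]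

/-- By `exists_pair` the elements of this form are closed under addition, hence a subpresheaf. The
unit factors through it, and by adjunction so does the identity of the extension. -/
lemma IsFlat.exists_eq_map_extendElt {φ : a ⥤ b} [φ.Additive] (hφ : IsFlat φ) {F : PSh a} {d : b}
    (y : ((extend φ).obj F).obj.obj (op d)) :
    ∃ (X : a) (x : F.obj.obj (op X)) (h : d ⟶ φ.obj X),
      ((extend φ).obj F).obj.map h.op (extendElt φ x) = y := by
  let S (d : b) : AddSubgroup (((extend φ).obj F).obj.obj (op d)) :=
    { carrier := {y | ∃ (X : a) (x : F.obj.obj (op X)) (h : d ⟶ φ.obj X),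
        ((extend φ).obj F).obj.map h.op (extendElt φ x) = y}
      zero_mem' := by
        obtain ⟨X⟩ := hφ.nonempty
        exact ⟨X, 0, 0, map_zero_apply _ _⟩
      add_mem' := by
        rintro _ _ ⟨X, x, h, rfl⟩ ⟨X', x', h', rfl⟩
        obtain ⟨Y, p, p', l, rfl, rfl⟩ := hφ.exists_pair h h'
        refine ⟨Y, F.obj.map p.op x + F.obj.map p'.op x', l, ?_⟩
        rw [extendElt_add, extendElt_map, extendElt_map, map_add, map_map, map_map]
      neg_mem' := by
        rintro _ ⟨X, x, h, rfl⟩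
        exact ⟨X, -x, h, by rw [extendElt_neg, map_neg]⟩ }
  have hS {d d' : b} (g : d' ⟶ d) {y : ((extend φ).obj F).obj.obj (op d)} (hy : y ∈ S d) :
      ((extend φ).obj F).obj.map g.op y ∈ S d' := by
    obtain ⟨X, x, h, rfl⟩ := hy
    exact ⟨X, x, g ≫ h, (map_map _ _ _ _).symm⟩
  obtain ⟨l, hl⟩ := exists_lift_of_injective ((restrict φ).map (subpresheafIncl _ S hS))
    (toExtend φ F) (fun X => subpresheafIncl_injective _ S hS (φ.obj X)) fun X x =>
      (exists_subpresheafIncl _ S hS).2 ⟨X, x, 𝟙 _, map_id_apply _ _⟩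
  have hid : ((extendAdj φ).homEquiv _ _).symm l ≫ subpresheafIncl _ S hS = 𝟙 _ := by
    rw [← Adjunction.homEquiv_naturality_right_symm, hl, Equiv.symm_apply_eq,
      Adjunction.homEquiv_id]
    rfl
  exact (exists_subpresheafIncl _ S hS).1
    ⟨_, congr_arg (fun m => m.hom.app (op d) y) hid⟩

/-- As in a filtered colimit, what vanishes in the extension vanishes at some stage. For coproducts
of representables only the finitely many components of `x` have to be killed, which `exists_kernel`
does one by one. -/
lemma IsFlat.exists_map_eq_zero {φ : a ⥤ b} [φ.Additive] (hφ : IsFlat φ) (F : PSh a) :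
    ∀ {d : b} {X : a} (x : F.obj.obj (op X)) (h : d ⟶ φ.obj X),
      ((extend φ).obj F).obj.map h.op (extendElt φ x) = 0 →
      ∃ (K : a) (i : K ⟶ X) (h' : d ⟶ φ.obj K), h' ≫ φ.map i = h ∧ F.obj.map i.op x = 0 := by
  induction F using presheaf_induction with
  | hcoprod I Y =>
    classical
    intro d X x h hx
    obtain ⟨s, hs⟩ := exists_finset_sum _ x
    choose k hk using fun i => yonedaElt_surjective
      ((Sigma.π (fun i => (yonedaPSh a).obj (Y i)) i).hom.app (op X) x)
    have hz (i : I) : h ≫ φ.map (k i) = 0 := by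
      have h1 := congr_arg (((extend φ).map (Sigma.π (fun i => (yonedaPSh a).obj (Y i)) i) ≫
        extendYonedaHom φ (Y i)).hom.app (op d)) hx
      rw [map_zero, map_app, comp_app, map_extendElt, ← hk, extendYonedaHom_extendElt,
        yonedaPSh_obj_map] at h1
      exact h1
    obtain ⟨K, i, h', hi, hh⟩ := hφ.exists_finset_kernel s k h hz
    refine ⟨K, i, h', hh, ?_⟩
    rw [hs, map_sum]
    refine Finset.sum_eq_zero fun j hj => ?_
    rw [← map_app, ← hk, yonedaPSh_obj_map, hi j hj]
    exact map_zero ((Sigma.ι (fun i => (yonedaPSh a).obj (Y i)) j).hom.app (op K)).hom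
  | @hcoker A B F r π w hc _ hB =>
    intro d X x h hx
    have : Epi π := epi_of_isColimit_cofork hc
    obtain ⟨y, rfl⟩ := (epi_iff_surjective π).1 inferInstance X x
    have w' : (extend φ).map r ≫ (extend φ).map π = 0 := by
      rw [← (extend φ).map_comp, w, (extend φ).map_zero]
    rw [← map_extendElt, ← map_app] at hx
    obtain ⟨z, hz⟩ := exists_of_isColimit_cokernel (w := w')
      (CokernelCofork.mapIsColimit _ hc (extend φ)) hx
    obtain ⟨X', x', h', rfl⟩ := hφ.exists_eq_map_extendElt z
    rw [map_app, map_extendElt] at hz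
    -- Over a common object `Y`, the lift `y` and the relation `r x'` agree in the extension of `B`;
    -- by induction they agree in `B` after a further restriction, and `π` kills the relation.
    obtain ⟨Y, p, p', l, rfl, rfl⟩ := hφ.exists_pair h h'
    obtain ⟨K, i, h', hh, hi⟩ := hB (B.obj.map p.op y - B.obj.map p'.op (r.hom.app _ x')) l (by
      rw [sub_eq_add_neg, extendElt_add, extendElt_neg, ← sub_eq_add_neg, extendElt_map,
        extendElt_map, map_sub, map_map, map_map, hz, sub_self])
    refine ⟨K, i ≫ p, h', by rw [φ.map_comp, ← Category.assoc, hh], ?_⟩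
    rw [map_sub, sub_eq_zero] at hi
    rw [← map_map, ← map_app, ← map_app, hi, ← map_app, ← map_app, ← comp_app, w, zero_app]

/-- Extension along a flat functor is exact. -/
lemma IsFlat.preservesFiniteLimits_extend {φ : a ⥤ b} [φ.Additive] (hφ : IsFlat φ) :
    PreservesFiniteLimits (extend φ) := by
  refine preservesFiniteLimits_of_preservesMono _ fun {A B} m _ => ?_
  rw [mono_iff_injective]
  intro d
  refine (injective_iff_map_eq_zero (((extend φ).map m).hom.app (op d)).hom).2 fun y hy => ?_
  obtain ⟨X, x, h, rfl⟩ := hφ.exists_eq_map_extendElt y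
  replace hy : ((extend φ).map m).hom.app (op d)
    (((extend φ).obj A).obj.map h.op (extendElt φ x)) = 0 := hy
  rw [map_app, map_extendElt] at hy
  -- The image of `x` already vanishes in `B` after restriction along `i`, so injectivity of `m`
  -- applies.
  obtain ⟨K, i, h', rfl, hi⟩ := hφ.exists_map_eq_zero B _ h hy
  rw [← map_app] at hi
  have hx : A.obj.map i.op x = 0 := (mono_iff_injective m).1 inferInstance K
    (hi.trans (map_zero (m.hom.app (op K)).hom).symm)
  rw [← map_map, ← extendElt_map, hx, extendElt_zero, map_zero]

end Flatness

/-! ### The kernel category: functoriality and kernels -/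

namespace Noy

open scoped ZeroObject

section Basic

variable {a : Type u} [Category.{v} a] [Preadditive a]

/-- The morphism of `Noy a` represented by `α`. -/
def homOf {f g : Noy a} (α : f.X₀ ⟶ g.X₀) (hα : ∃ β : f.X₁ ⟶ g.X₁, f.hom ≫ β = α ≫ g.hom) :
    f ⟶ g := mkHom f g ⟨α, hα⟩

lemma exists_homOf {f g : Noy a} (m : f ⟶ g) : ∃ α hα, homOf α hα = m := by
  obtain ⟨α, rfl⟩ := mkHom_surjective f g m
  exact ⟨α.1, α.2, rfl⟩

lemma homOf_eq_zero_iff {f g : Noy a} {α : f.X₀ ⟶ g.X₀} {hα} :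
    homOf (f := f) (g := g) α hα = 0 ↔ ∃ h : f.X₁ ⟶ g.X₀, f.hom ≫ h = α := by
  rw [show (0 : f ⟶ g) = mkHom f g 0 from (map_zero (mkHom f g)).symm, eq_comm]
  refine mkHom_eq_iff.trans ?_
  simp

/-- The functor `Noy a ⥤ Noy b` induced by an additive functor `a ⥤ b`. -/
def mapNoy {b : Type u'} [Category.{v} b] [Preadditive b] (φ : a ⥤ b) [φ.Additive] :
    Noy a ⥤ Noy b where
  obj f := ⟨φ.map f.hom⟩
  map {f g} := QuotientAddGroup.map _ _
    (AddMonoidHom.mk' (fun α : admissible f g => (⟨φ.map α.1, by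
        obtain ⟨β, hβ⟩ := mem_admissible.1 α.2
        exact mem_admissible.2 ⟨φ.map β, by rw [← φ.map_comp, hβ, φ.map_comp]⟩⟩ :
          admissible (⟨φ.map f.hom⟩ : Noy b) ⟨φ.map g.hom⟩))
      fun α β => Subtype.ext φ.map_add) (by
      rintro α ⟨β, hβ⟩
      refine ⟨φ.map β, ?_⟩
      exact (φ.map_comp _ _).symm.trans (congr_arg φ.map hβ))
  map_id f := congr_arg (mkHom _ _) (Subtype.ext (φ.map_id _))
  map_comp {f g h} m n := by
    obtain ⟨α, rfl⟩ := mkHom_surjective f g m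
    obtain ⟨β, rfl⟩ := mkHom_surjective g h n
    exact congr_arg (mkHom _ _) (Subtype.ext (φ.map_comp _ _))

section MapNoy

variable {b : Type u'} [Category.{v} b] [Preadditive b] (φ : a ⥤ b) [φ.Additive]

instance : (mapNoy φ).Additive where
  map_add {_ _ m n} := map_add (QuotientAddGroup.map _ _ _ _) m n

/-- Pairs are handled by biproducts in `Noy a`. A kernel of `α` from `f : X⁰ ⟶ X¹` to `g : Y⁰ ⟶ Y¹`
is represented by `(f, α) : X⁰ ⟶ X¹ ⊞ Y⁰`, with the identity of `X⁰` as inclusion; this description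
is compatible with additive functors. -/
lemma isFlat_mapNoy [HasZeroObject a] [HasBinaryBiproducts a] : IsFlat (mapNoy φ) where
  nonempty := ⟨⟨𝟙 (0 : a)⟩⟩
  exists_pair {d f g} h h' := by
    let y : Noy a := ⟨biprod.map f.hom g.hom⟩
    let p : y ⟶ f := homOf (f := y) (g := f) biprod.fst ⟨biprod.fst, by simp [y]⟩
    let p' : y ⟶ g := homOf (f := y) (g := g) biprod.snd ⟨biprod.snd, by simp [y]⟩
    let i : f ⟶ y := homOf (f := f) (g := y) biprod.inl ⟨biprod.inl, by simp [y]⟩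
    let i' : g ⟶ y := homOf (f := g) (g := y) biprod.inr ⟨biprod.inr, by simp [y]⟩
    have h1 : i ≫ p = 𝟙 f := by
      change homOf _ _ = homOf _ _
      congr 1
      exact biprod.inl_fst
    have h2 : i ≫ p' = 0 := homOf_eq_zero_iff.2 ⟨0, by simp⟩
    have h3 : i' ≫ p = 0 := homOf_eq_zero_iff.2 ⟨0, by simp⟩
    have h4 : i' ≫ p' = 𝟙 g := by
      change homOf _ _ = homOf _ _
      congr 1
      exact biprod.inr_snd
    refine ⟨y, p, p', h ≫ (mapNoy φ).map i + h' ≫ (mapNoy φ).map i', ?_, ?_⟩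
    · simp only [Preadditive.add_comp, Category.assoc, ← Functor.map_comp, h1, h3]
      simp
    · simp only [Preadditive.add_comp, Category.assoc, ← Functor.map_comp, h2, h4]
      simp
  exists_kernel {d f g} k h w := by
    obtain ⟨α, hα, rfl⟩ := exists_homOf k
    obtain ⟨(γ : d.X₀ ⟶ φ.obj f.X₀), ⟨(t : d.X₁ ⟶ φ.obj f.X₁), ht⟩, rfl⟩ := exists_homOf h
    replace ht : d.hom ≫ t = γ ≫ φ.map f.hom := ht
    obtain ⟨(s : d.X₁ ⟶ φ.obj g.X₀), (hs : d.hom ≫ s = γ ≫ φ.map α)⟩ := homOf_eq_zero_iff.1 w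
    -- `t` witnesses that `γ` is admissible and `s` that the composite vanishes; together they make
    -- `γ` admissible into the kernel.
    have hts : d.hom ≫ (t ≫ φ.map biprod.inl + s ≫ φ.map biprod.inr) =
        γ ≫ φ.map (biprod.lift f.hom α) := by
      have : biprod.lift f.hom α = f.hom ≫ biprod.inl + α ≫ biprod.inr := by
        ext <;> simp
      rw [this, φ.map_add, φ.map_comp, φ.map_comp, Preadditive.comp_add, Preadditive.comp_add]
      simp only [← Category.assoc]
      rw [ht, hs]
    let y : Noy a := ⟨biprod.lift f.hom α⟩
    refine ⟨y, homOf (f := y) (g := f) (𝟙 f.X₀) ⟨biprod.fst, by simp [y]⟩,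
      homOf (f := d) (g := (mapNoy φ).obj y) γ ⟨_, hts⟩,
      homOf_eq_zero_iff.2 ⟨biprod.snd, by simp [y]⟩, ?_⟩
    change homOf _ _ = homOf _ _
    congr 1
    exact (congr_arg (γ ≫ ·) (φ.map_id f.X₀)).trans (Category.comp_id γ)

/-- The functor `mapNoy φ` extends `φ`. -/
def nMapNoyIso [HasZeroObject a] [HasZeroObject b] : N a ⋙ mapNoy φ ≅ φ ⋙ N b :=
  NatIso.ofComponents (fun A =>
    { hom := homOf (f := (mapNoy φ).obj ((N a).obj A)) (g := (N b).obj (φ.obj A)) (𝟙 (φ.obj A))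
        ⟨0, comp_zero.trans comp_zero.symm⟩
      inv := homOf (g := (mapNoy φ).obj ((N a).obj A)) (f := (N b).obj (φ.obj A)) (𝟙 (φ.obj A))
        ⟨0, comp_zero.trans
          ((congr_arg (𝟙 (φ.obj A) ≫ ·) (φ.map_zero A 0)).trans comp_zero).symm⟩
      hom_inv_id := by
        change homOf _ _ = homOf _ _
        congr 1
        exact Category.comp_id _
      inv_hom_id := by
        change homOf _ _ = homOf _ _
        congr 1
        exact Category.comp_id _ })
    fun {A B} f => by
      change homOf _ _ = homOf _ _
      congr 1
      exact (Category.comp_id _).trans (Category.id_comp _).symm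

end MapNoy

section Vec

variable {C : Type w} [Category.{v₁} C] [Preadditive C] [HasKernels C] (θ : a ⥤ C) [θ.Additive]

/-- The inclusion of `ker θ(f)` into the value of `θ` on the source of `f`. -/
def vecι (f : Noy a) : (vec θ).obj f ⟶ θ.obj f.X₀ := kernel.ι (θ.map f.hom)

lemma vecι_comp (f : Noy a) : vecι θ f ≫ θ.map f.hom = 0 := kernel.condition (θ.map f.hom)

instance (f : Noy a) : Mono (vecι θ f) := inferInstanceAs (Mono (kernel.ι (θ.map f.hom)))

/-- The factorization of a morphism through `ker θ(f)`. -/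
def vecLift (f : Noy a) {W : C} (k : W ⟶ θ.obj f.X₀) (hk : k ≫ θ.map f.hom = 0) :
    W ⟶ (vec θ).obj f := kernel.lift _ k hk

lemma vecLift_comp (f : Noy a) {W : C} (k : W ⟶ θ.obj f.X₀) (hk : k ≫ θ.map f.hom = 0) :
    vecLift θ f k hk ≫ vecι θ f = k := kernel.lift_ι _ _ _

lemma vec_map_homOf {f g : Noy a} (α : f.X₀ ⟶ g.X₀) (hα) :
    (vec θ).map (homOf α hα) ≫ vecι θ g = vecι θ f ≫ θ.map α :=
  vecMap_ι θ ⟨α, hα⟩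

end Vec

variable [HasZeroObject a]

instance : (N a).Faithful where
  map_injective {A B f g} h := by
    obtain ⟨k, hk⟩ := mkHom_eq_iff.1 h
    replace hk : (0 : A ⟶ (0 : a)) ≫ k = g - f := hk
    rw [zero_comp, eq_comm, sub_eq_zero] at hk
    exact hk.symm

instance : (N a).Full where
  map_surjective m := by
    obtain ⟨α, hα, rfl⟩ := exists_homOf m
    exact ⟨α, rfl⟩

/-- The canonical morphism from `f` to its source. -/
def proj (f : Noy a) : f ⟶ (N a).obj f.X₀ :=
  homOf (f := f) (g := (N a).obj f.X₀) (𝟙 f.X₀) ⟨0, comp_zero.trans comp_zero.symm⟩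

/-- Together with `Mono (proj f)` and `exists_comp_proj`, this exhibits `f` as the kernel of `N f`.
-/
lemma proj_comp (f : Noy a) : proj f ≫ (N a).map f.hom = 0 :=
  homOf_eq_zero_iff.2 ⟨𝟙 _, (Category.comp_id _).trans (Category.id_comp _).symm⟩

lemma homOf_comp_proj {f g : Noy a} (α : f.X₀ ⟶ g.X₀) (hα) :
    homOf α hα ≫ proj g = proj f ≫ (N a).map α := by
  change homOf _ _ = homOf _ _
  congr 1
  exact (Category.comp_id _).trans (Category.id_comp _).symm

instance (f : Noy a) : Mono (proj f) where
  right_cancellation {g} m n h := by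
    rw [← sub_eq_zero, ← Preadditive.sub_comp] at h
    rw [← sub_eq_zero]
    generalize m - n = k at h ⊢
    obtain ⟨α, hα, rfl⟩ := exists_homOf k
    rw [homOf_comp_proj] at h
    obtain ⟨t, ht⟩ := homOf_eq_zero_iff.1 h
    exact homOf_eq_zero_iff.2 ⟨t, ht.trans (Category.id_comp _)⟩

lemma exists_comp_proj {f g : Noy a} (m : g ⟶ (N a).obj f.X₀) (h : m ≫ (N a).map f.hom = 0) :
    ∃ l, l ≫ proj f = m := by
  obtain ⟨α, hα, rfl⟩ := exists_homOf m
  obtain ⟨t, ht⟩ := homOf_eq_zero_iff.1 h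
  refine ⟨homOf (f := g) (g := f) α ⟨t, ht⟩, ?_⟩
  change homOf _ _ = homOf _ _
  congr 1
  exact Category.comp_id _

section PreservesProj

variable {C : Type w} [Category.{v₁} C] [Preadditive C]

/-- A functor on `Noy a` is exact if it sends `f` to the kernel of the image of `N f`. -/
structure PreservesKernels (G : Noy a ⥤ C) : Prop where
  comp_eq_zero (f : Noy a) : G.map (proj f) ≫ G.map ((N a).map f.hom) = 0
  isLimit (f : Noy a) : Nonempty (IsLimit (KernelFork.ofι (G.map (proj f)) (comp_eq_zero f)))

lemma PreservesKernels.comp {G : Noy a ⥤ C} (hG : PreservesKernels G) {D : Type*} [Category* D]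
    [Preadditive D] (E : C ⥤ D) [E.PreservesZeroMorphisms] [PreservesFiniteLimits E] :
    PreservesKernels (G ⋙ E) where
  comp_eq_zero f := by
    simp only [Functor.comp_map, ← E.map_comp, hG.comp_eq_zero, E.map_zero]
  isLimit f := ⟨KernelFork.mapIsLimit _ (hG.isLimit f).some E⟩

lemma preservesKernels_yonedaPSh : PreservesKernels (yonedaPSh (Noy a)) where
  comp_eq_zero f := by rw [← Functor.map_comp, proj_comp, Functor.map_zero]
  isLimit f := isKernel_of_exact _ _ _
    (fun g m n h => by
      obtain ⟨m, rfl⟩ := yonedaElt_surjective m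
      obtain ⟨n, rfl⟩ := yonedaElt_surjective n
      exact (cancel_mono (proj f)).1 h)
    (fun g m h => by
      obtain ⟨m, rfl⟩ := yonedaElt_surjective m
      obtain ⟨l, hl⟩ := exists_comp_proj m h
      exact ⟨yonedaElt l, hl⟩)

lemma PreservesKernels.mono {G : Noy a ⥤ C} (hG : PreservesKernels G) (f : Noy a) :
    Mono (G.map (proj f)) := mono_of_isLimit_fork (hG.isLimit f).some

lemma PreservesKernels.exists_lift {G : Noy a ⥤ C} (hG : PreservesKernels G) (f : Noy a) {W : C}
    (k : W ⟶ G.obj ((N a).obj f.X₀)) (hk : k ≫ G.map ((N a).map f.hom) = 0) :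
    ∃ l : W ⟶ G.obj f, l ≫ G.map (proj f) = k :=
  ⟨(hG.isLimit f).some.lift (KernelFork.ofι k hk), Fork.IsLimit.lift_ι (hG.isLimit f).some⟩

variable [HasKernels C]

/-- A kernel-preserving functor on `Noy a` is determined by its values on `a`. -/
def vecIso {G : Noy a ⥤ C} (hG : PreservesKernels G) (θ : a ⥤ C) [θ.Additive]
    (e : N a ⋙ G ≅ θ) : G ≅ vec θ := by
  have he (f : Noy a) : G.map ((N a).map f.hom) ≫ e.hom.app f.X₁ =
    e.hom.app f.X₀ ≫ θ.map f.hom := e.hom.naturality f.hom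
  have he' (f : Noy a) : e.inv.app f.X₀ ≫ G.map ((N a).map f.hom) =
    θ.map f.hom ≫ e.inv.app f.X₁ := (e.inv.naturality f.hom).symm
  have hι (f : Noy a) : (G.map (proj f) ≫ e.hom.app f.X₀) ≫ θ.map f.hom = 0 := by
    rw [Category.assoc, ← he, ← Category.assoc, hG.comp_eq_zero, zero_comp]
  -- Up to `e`, both objects are kernels of `θ f`; the inverse comes from the universal property of
  -- `G f`.
  have hiso (f : Noy a) : IsIso (vecLift θ f _ (hι f)) := by
    have := hG.mono f
    obtain ⟨l, hl⟩ := hG.exists_lift f (vecι θ f ≫ e.inv.app f.X₀) (by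
      rw [Category.assoc, he', ← Category.assoc, vecι_comp, zero_comp])
    refine ⟨l, ?_, ?_⟩
    · rw [← cancel_mono (G.map (proj f)), Category.assoc, hl, ← Category.assoc, vecLift_comp,
        Category.assoc, e.hom_inv_id_app, Category.id_comp]
      exact Category.comp_id _
    · rw [← cancel_mono (vecι θ f), Category.assoc, vecLift_comp, ← Category.assoc, hl,
        Category.assoc, e.inv_hom_id_app, Category.id_comp, Category.comp_id]
  refine NatIso.ofComponents (fun f => asIso (vecLift θ f _ (hι f))) fun {f g} m => ?_
  obtain ⟨α, hα, rfl⟩ := exists_homOf m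
  have h1 : G.map ((N a).map α) ≫ e.hom.app g.X₀ = e.hom.app f.X₀ ≫ θ.map α :=
    e.hom.naturality α
  have h2 := congr_arg G.map (homOf_comp_proj α hα)
  rw [G.map_comp, G.map_comp] at h2
  rw [← cancel_mono (vecι θ g), asIso_hom, asIso_hom, Category.assoc, vecLift_comp, Category.assoc,
    vec_map_homOf, ← Category.assoc, h2, Category.assoc, h1, ← Category.assoc (vecLift θ f _ _),
    vecLift_comp, Category.assoc]

end PreservesProj

end Basic

end Noy

/-! ### The embedding `ι` and its image -/

section Iota

variable {a : Type u} [Category.{v} a] [Preadditive a] [HasZeroObject a]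

/-- The sieve of those `g` for which `N g ≫ α` lies in a sieve on an object of `Noy a`. -/
def AddSieve.comapN {f : Noy a} (R : AddSieve f) {Y : a} (α : (Noy.N a).obj Y ⟶ f) :
    AddSieve Y where
  arrows Z := (R.arrows _).comap
    (AddMonoidHom.mk' (fun g : Z ⟶ Y => (Noy.N a).map g ≫ α) fun g h => by
      rw [Functor.map_add, Preadditive.add_comp])
  comp_mem {Y Z} g h hh := by
    have := R.comp_mem ((Noy.N a).map g) hh
    rwa [AddMonoidHom.mk'_apply, ← Category.assoc, ← Functor.map_comp] at this

lemma AddSieve.mem_comapN {f : Noy a} {R : AddSieve f} {Y Z : a} {α : (Noy.N a).obj Y ⟶ f}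
    {g : Z ⟶ Y} : g ∈ (R.comapN α).arrows Z ↔ (Noy.N a).map g ≫ α ∈ R.arrows _ := Iff.rfl

lemma AddSieve.comapN_pullback {f g : Noy a} (R : AddSieve f) (m : g ⟶ f) {Y : a}
    (α : (Noy.N a).obj Y ⟶ g) : (R.pullback m).comapN α = R.comapN (α ≫ m) := by
  rw [AddSieve.ext_iff_mem]
  intro Z k
  rw [mem_comapN, mem_pullback, mem_comapN, Category.assoc]

lemma AddSieve.pullback_comapN {f : Noy a} (R : AddSieve f) {X Y : a} (α : (Noy.N a).obj X ⟶ f)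
    (h : Y ⟶ X) : (R.comapN α).pullback h = R.comapN ((Noy.N a).map h ≫ α) := by
  rw [AddSieve.ext_iff_mem]
  intro Z k
  rw [mem_comapN, mem_pullback, mem_comapN, Functor.map_comp, Category.assoc]

/-- The largest sieve on `N X` that restricts to a given sieve on `X`. -/
def AddSieve.mapN {X : a} (R : AddSieve X) : AddSieve ((Noy.N a).obj X) where
  arrows f :=
    { carrier := {m | ∀ (Y : a) (α : (Noy.N a).obj Y ⟶ f) (h : Y ⟶ X),
        (Noy.N a).map h = α ≫ m → h ∈ R.arrows Y}
      zero_mem' Y α h hh := by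
        rw [comp_zero, Functor.map_eq_zero_iff] at hh
        rw [hh]
        exact zero_mem _
      add_mem' {m n} hm hn Y α h hh := by
        -- Fullness of `N` splits `h` into a part belonging to `m` and a part belonging to `n`.
        obtain ⟨k, hk⟩ := (Noy.N a).map_surjective (α ≫ m)
        have := hn Y α (h - k) (by
          rw [Functor.map_sub, hh, hk, Preadditive.comp_add, add_sub_cancel_left])
        simpa using add_mem this (hm Y α k hk)
      neg_mem' {m} hm Y α h hh := by
        have := hm Y α (-h) (by rw [Functor.map_neg, hh, Preadditive.comp_neg, neg_neg])
        simpa using this }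
  comp_mem {f g} k m hm Y α h hh := hm Y (α ≫ k) h (by rw [hh, Category.assoc])

lemma AddSieve.mem_mapN {X : a} {R : AddSieve X} {f : Noy a} {m : f ⟶ (Noy.N a).obj X} :
    m ∈ R.mapN.arrows f ↔ ∀ (Y : a) (α : (Noy.N a).obj Y ⟶ f) (h : Y ⟶ X),
      (Noy.N a).map h = α ≫ m → h ∈ R.arrows Y := Iff.rfl

lemma AddSieve.comapN_mapN {X : a} (R : AddSieve X) : R.mapN.comapN (𝟙 _) = R := by
  rw [AddSieve.ext_iff_mem]
  intro Y g
  rw [mem_comapN, Category.comp_id, mem_mapN]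
  refine ⟨fun h => h Y (𝟙 _) g (Category.id_comp _).symm, fun hg Z α h hh => ?_⟩
  obtain ⟨k, rfl⟩ := (Noy.N a).map_surjective α
  rw [← Functor.map_comp] at hh
  rw [(Noy.N a).map_injective hh]
  exact R.comp_mem k hg

lemma AddSieve.mapN_pullback {X Y : a} (R : AddSieve X) (h : Y ⟶ X) :
    (R.pullback h).mapN = R.mapN.pullback ((Noy.N a).map h) := by
  rw [AddSieve.ext_iff_mem]
  intro f m
  rw [mem_pullback, mem_mapN, mem_mapN]
  refine ⟨fun H Z α k hk => ?_, fun H Z α k hk => H Z α (k ≫ h) ?_⟩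
  · obtain ⟨l, hl⟩ := (Noy.N a).map_surjective (α ≫ m)
    rw [← Category.assoc, ← hl, ← Functor.map_comp] at hk
    rw [(Noy.N a).map_injective hk]
    exact H Z α l hl
  · rw [Functor.map_comp, hk, Category.assoc]

lemma GTop.eq_maximal_mem {c : Type*} [Category* c] [Preadditive c] (T : GTop c) {X : c}
    {R : AddSieve X} (h : 𝟙 X ∈ R.arrows X) : R ∈ T.1 X :=
  T.mem_of_le (T.2.maximal_mem X) fun Y f _ => by simpa using R.comp_mem f h

/-- The homological topology associated with a topology: a sieve on `f` is covering if its
restrictions to objects of `a` over `f` are. -/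
def iotaSystem (T : CoveringSystem a) : CoveringSystem (Noy a) := fun f =>
  {R | ∀ (Y : a) (α : (Noy.N a).obj Y ⟶ f), R.comapN α ∈ T Y}

lemma isTopology_iotaSystem (T : GTop a) : IsTopology (iotaSystem T.1) where
  maximal_mem f Y α := T.eq_maximal_mem trivial
  pullback_mem m R hR Y α := by
    rw [AddSieve.comapN_pullback]
    exact hR Y _
  local_mem {f} S R hS hR Y α := by
    refine T.2.local_mem _ _ (hS Y α) fun Z g hg => ?_
    have := hR _ _ (AddSieve.mem_comapN.1 hg) Z (𝟙 _)
    rwa [AddSieve.comapN_pullback, Category.id_comp, ← AddSieve.pullback_comapN] at this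

/-- Recovers `T` from its image, which gives injectivity of `ι`. -/
lemma mapN_mem_iotaSystem_iff (T : GTop a) {X : a} {R : AddSieve X} :
    R.mapN ∈ iotaSystem T.1 ((Noy.N a).obj X) ↔ R ∈ T.1 X := by
  constructor
  · intro h
    simpa only [AddSieve.comapN_mapN] using h X (𝟙 _)
  · intro h Y α
    obtain ⟨k, rfl⟩ := (Noy.N a).map_surjective α
    rw [← Category.comp_id ((Noy.N a).map k), ← AddSieve.pullback_comapN, AddSieve.comapN_mapN]
    exact T.2.pullback_mem _ _ h

variable (a) in
/-- The embedding of topologies into homological topologies. -/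
def iota : GTop a ↪ HTop a where
  toFun T := ⟨iotaSystem T.1, isTopology_iotaSystem T⟩
  inj' T T' h := by
    have h : iotaSystem T.1 = iotaSystem T'.1 := congr_arg Subtype.val h
    refine Subtype.ext (funext fun X => Set.ext fun R => ?_)
    rw [← mapN_mem_iotaSystem_iff T, ← mapN_mem_iotaSystem_iff T', h]

lemma canonicalSieve_mem_iota (T : GTop a) (f : Noy a) :
    Noy.canonicalSieve f ∈ (iota a T).1 f := fun Y α =>
  T.eq_maximal_mem (AddSubgroup.subset_closure ⟨⟨Y, α⟩, (Noy.N a).map (𝟙 Y), rfl⟩)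

/-- Local character along `R_f`. Its elements are sums of morphisms through objects `N Y`, and the
morphisms along which `Q` pulls back to a covering sieve are closed under sums because coverings are
closed under intersection. -/
lemma HTop.mem_of_forall_N (R : HTop a) {f : Noy a} (hf : Noy.canonicalSieve f ∈ R.1 f)
    {Q : AddSieve f} (h : ∀ (Y : a) (α : (Noy.N a).obj Y ⟶ f), Q.pullback α ∈ R.1 _) :
    Q ∈ R.1 f := by
  refine R.2.local_mem _ _ hf fun g m hm => ?_
  induction hm using AddSubgroup.closure_induction with
  | mem m hm =>
    obtain ⟨i, k, rfl⟩ := hm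
    refine R.mem_of_le (R.2.pullback_mem k _ (h i.1 i.2)) fun Y l hl => ?_
    rw [AddSieve.mem_pullback, AddSieve.mem_pullback, Category.assoc] at hl
    exact hl
  | zero =>
    refine R.eq_maximal_mem ?_
    rw [AddSieve.mem_pullback, comp_zero]
    exact zero_mem _
  | add m n _ _ hm hn =>
    refine R.mem_of_inter_le hm hn fun Y k hk hk' => ?_
    rw [AddSieve.mem_pullback, Preadditive.comp_add]
    exact add_mem hk hk'
  | neg m _ hm =>
    refine R.mem_of_le hm fun Y k hk => ?_
    rw [AddSieve.mem_pullback, Preadditive.comp_neg]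
    exact neg_mem hk

/-- This is the topology whose image under `ι` will be `R`. -/
lemma isTopology_mapN (R : HTop a) (hR : ∀ f : Noy a, Noy.canonicalSieve f ∈ R.1 f) :
    IsTopology (fun X : a => {S | S.mapN ∈ R.1 ((Noy.N a).obj X)}) where
  maximal_mem X := R.eq_maximal_mem fun _ _ _ _ => trivial
  pullback_mem f S hS := by
    rw [Set.mem_ofPred_eq, AddSieve.mapN_pullback]
    exact R.2.pullback_mem _ _ hS
  local_mem {X} S Q hS hQ := by
    refine R.2.local_mem _ _ hS fun f m hm => R.mem_of_forall_N (hR f) fun Y α => ?_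
    obtain ⟨h, hh⟩ := (Noy.N a).map_surjective (α ≫ m)
    have := hQ Y h (hm Y α h hh)
    rw [Set.mem_ofPred_eq, AddSieve.mapN_pullback, hh] at this
    refine R.mem_of_le this fun g k hk => ?_
    rw [AddSieve.mem_pullback] at hk ⊢
    rwa [AddSieve.mem_pullback, Category.assoc]

/-- Restricting to `a` and returning enlarges the inverse image without changing its elements on
objects of `a`, and by `hR` these elements decide whether it covers. -/
lemma mapN_comapN_mem_iff (R : HTop a) (hR : ∀ f : Noy a, Noy.canonicalSieve f ∈ R.1 f)
    {f : Noy a} (S : AddSieve f) {Y : a} (α : (Noy.N a).obj Y ⟶ f) :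
    (S.comapN α).mapN ∈ R.1 ((Noy.N a).obj Y) ↔ S.pullback α ∈ R.1 ((Noy.N a).obj Y) := by
  constructor
  · intro h
    refine R.2.local_mem _ _ h fun g m hm => R.mem_of_forall_N (hR g) fun Z β => ?_
    obtain ⟨k, hk⟩ := (Noy.N a).map_surjective (β ≫ m)
    have : (Noy.N a).map k ≫ α ∈ S.arrows _ := hm Z β k hk
    refine R.eq_maximal_mem ?_
    rw [AddSieve.mem_pullback, AddSieve.mem_pullback, AddSieve.mem_pullback, Category.id_comp, ← hk]
    exact this
  · intro h
    refine R.mem_of_le h fun g m hm Z β k hk => ?_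
    rw [AddSieve.mem_comapN, hk, Category.assoc]
    exact S.comp_mem β hm

lemma range_iota : Set.range (iota a) = {R : HTop a | ∀ f : Noy a, Noy.canonicalSieve f ∈ R.1 f} := by
  apply Set.Subset.antisymm
  · rintro _ ⟨T, rfl⟩
    exact canonicalSieve_mem_iota T
  · intro R hR
    refine ⟨⟨_, isTopology_mapN R hR⟩, Subtype.ext (funext fun f => Set.ext fun S => ?_)⟩
    change (∀ (Y : a) (α : (Noy.N a).obj Y ⟶ f), (S.comapN α).mapN ∈ R.1 _) ↔ S ∈ R.1 f
    simp only [mapN_comapN_mem_iff R hR]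
    exact ⟨R.mem_of_forall_N (hR f), fun h Y α => R.2.pullback_mem _ _ h⟩

end Iota

/-! ### Prexact functors on `a` and their extensions to `Noy a` -/

section Comparison

variable {a : Type u} [Category.{v} a] [Preadditive a] [HasZeroObject a]

lemma sieveOf_restrict_incl {f : Noy a} (R : AddSieve f) {Y : a} (α : (Noy.N a).obj Y ⟶ f) :
    sieveOf ((restrict (Noy.N a)).map R.incl) (X := Y) (yonedaElt α) = R.comapN α := by
  rw [AddSieve.ext_iff_mem]
  intro Z g
  refine ⟨?_, fun h => ⟨⟨_, h⟩, rfl⟩⟩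
  rintro ⟨x, hx⟩
  rw [AddSieve.mem_comapN, show (Noy.N a).map g ≫ α = x.1 from hx.symm]
  exact x.2

variable [EssentiallySmall.{v} a]

/-- Restriction along a fully faithful functor is compatible with the Yoneda embeddings. -/
def yonedaRestrictIso {b : Type u'} [Category.{v} b] [Preadditive b] (φ : a ⥤ b) [φ.Additive]
    [φ.Full] [φ.Faithful] : φ ⋙ yonedaPSh b ⋙ restrict φ ≅ yonedaPSh a :=
  have (F : PSh a) : IsIso ((extendAdj φ).unit.app F) := isIso_toExtend φ F
  have : IsIso (extendAdj φ).unit := NatIso.isIso_of_isIso_app _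
  (Functor.associator _ _ _).symm ≪≫ Functor.isoWhiskerRight (yonedaExtendIso φ).symm _ ≪≫
    Functor.associator _ _ _ ≪≫
      Functor.isoWhiskerLeft (yonedaPSh a) (asIso (extendAdj φ).unit).symm ≪≫
        Functor.rightUnitor _

variable {C : Type w} [Category.{v₁} C] [Abelian C]

/-- The reason for the definition of `ι`: the restricted inclusion of `R` is tested on the elements
of the restricted representable, that is, on morphisms `N Y ⟶ f`, and the sieves that they cut out
are the restrictions of `R`. -/
lemma coveringSystem_yoneda_restrict [HasCoproducts.{v} C] (Θ : PSh a ⥤ C)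
    [PreservesColimitsOfSize.{v, v} Θ] [PreservesFiniteLimits Θ] :
    coveringSystem (yonedaPSh (Noy a) ⋙ restrict (Noy.N a) ⋙ Θ) =
      iotaSystem (coveringSystem (yonedaPSh a ⋙ Θ)) := by
  funext f
  ext R
  rw [mem_coveringSystem_iff_epi, Functor.comp_map, epi_map_iff_sieveOf]
  refine forall_congr' fun Y => ?_
  simp only [mem_coveringSystem_iff_epi]
  constructor
  · intro h α
    rw [← sieveOf_restrict_incl]
    exact h _
  · intro h x
    obtain ⟨α, rfl⟩ := yonedaElt_surjective (X := f) (Y := (Noy.N a).obj Y) x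
    have := h α
    rw [← sieveOf_restrict_incl] at this
    exact this

/-- The extension to `Noy a` of the restriction of an exact functor on presheaves. -/
def vecPrexactIso (Θ : PSh a ⥤ C) [PreservesColimitsOfSize.{v, v} Θ] [PreservesFiniteLimits Θ]
    (θ : a ⥤ C) [θ.Additive] (e : yonedaPSh a ⋙ Θ ≅ θ) :
    yonedaPSh (Noy a) ⋙ restrict (Noy.N a) ⋙ Θ ≅ Noy.vec θ :=
  Noy.vecIso (Noy.preservesKernels_yonedaPSh.comp (restrict (Noy.N a) ⋙ Θ)) θ
    (Functor.isoWhiskerRight (yonedaRestrictIso (Noy.N a)) Θ ≪≫ e)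

/-- Restriction followed by `Θ` is exact, so on `Noy a` it preserves kernels; on `a` it is `θ`. This
determines it as `vec θ`. -/
lemma Prexact.vec {θ : a ⥤ C} [θ.Additive] (h : Prexact θ) : Prexact (Noy.vec θ) := by
  obtain ⟨Θ, _, ⟨e⟩, _⟩ := h
  exact ⟨restrict (Noy.N a) ⋙ Θ, inferInstance, ⟨vecPrexactIso Θ θ e⟩, inferInstance⟩

lemma Prexact.coveringSystem_vec [HasCoproducts.{v} C] {θ : a ⥤ C} [θ.Additive] (h : Prexact θ) :
    coveringSystem (Noy.vec θ) = iotaSystem (coveringSystem θ) := by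
  obtain ⟨Θ, _, ⟨e⟩, _⟩ := h
  rw [← coveringSystem_congr e, ← coveringSystem_yoneda_restrict,
    coveringSystem_congr (vecPrexactIso Θ θ e)]

end Comparison

/-! ### Equivalence of sheaf categories and induced homological topologies -/

section Main

open scoped ZeroObject

attribute [local instance] abelianSh

variable {a : Type u} [Category.{v} a] [Preadditive a] [HasZeroObject a] [EssentiallySmall.{v} a]

lemma coveringSystem_restrict_sheafify (T : GTop a) :
    coveringSystem (yonedaPSh (Noy a) ⋙ restrict (Noy.N a) ⋙ sheafify T) = (iota a T).1 :=
  (coveringSystem_yoneda_restrict (sheafify T)).trans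
    (congr_arg iotaSystem (coveringSystem_sheafYoneda T))

lemma isIso_restrict_sheafify_iff (T : GTop a) {A B : PSh (Noy a)} (f : A ⟶ B) :
    IsIso ((restrict (Noy.N a) ⋙ sheafify T).map f) ↔ IsIso ((sheafify (iota a T)).map f) :=
  isIso_map_iff_of_coveringSystem_eq _ _
    ((coveringSystem_restrict_sheafify T).trans (coveringSystem_sheafYoneda (iota a T)).symm) f

/-- The morphisms of presheaves inverted by sheafification for `ι(T)`. -/
abbrev iotaLocalIsos (T : GTop a) : MorphismProperty (PSh (Noy a)) :=
  (MorphismProperty.isomorphisms _).inverseImage (sheafify (iota a T))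

instance isLocalization_sheafify_iota (T : GTop a) :
    (sheafify (iota a T)).IsLocalization (iotaLocalIsos T) :=
  (sheafifyAdj (iota a T)).isLocalization

/-- Up to the invertible unit, `f` is the restriction of its extension. Such a lift is what
composing the two localizations requires. -/
lemma map_restrict_iotaLocalIsos (T : GTop a) {A B : PSh a} (f : A ⟶ B)
    (hf : IsIso ((sheafify T).map f)) : (iotaLocalIsos T).map (restrict (Noy.N a)) f := by
  let i (F : PSh a) : F ≅ (restrict (Noy.N a)).obj ((extend (Noy.N a)).obj F) :=
    asIso (toExtend (Noy.N a) F)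
  have e : Arrow.mk f ≅ Arrow.mk ((restrict (Noy.N a)).map ((extend (Noy.N a)).map f)) :=
    Arrow.isoMk (i A) (i B)
      ((extendAdj (Noy.N a)).unit.naturality f).symm
  refine (MorphismProperty.arrow_mk_iso_iff _ e).2 (MorphismProperty.map_mem_map _ _ _
    ((isIso_restrict_sheafify_iff T _).1 ?_))
  exact ((MorphismProperty.isomorphisms _).inverseImage (sheafify T)).arrow_mk_iso_iff e |>.1 hf

/-- Restriction is a localization since its left adjoint is fully faithful, and sheafification since
its right adjoint is. -/
instance isLocalization_restrict_sheafify (T : GTop a) :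
    (restrict (Noy.N a) ⋙ sheafify T).IsLocalization (iotaLocalIsos T) := by
  have := (extendAdj (Noy.N a)).isLocalization'
  have := (sheafifyAdj T).isLocalization
  refine Functor.IsLocalization.comp (restrict (Noy.N a)) (sheafify T)
    ((MorphismProperty.isomorphisms _).inverseImage (restrict (Noy.N a)))
    ((MorphismProperty.isomorphisms _).inverseImage (sheafify T)) _
    (fun A B f hf => (isIso_restrict_sheafify_iff T f).2 hf) (fun A B f hf => ?_)
    (fun A B f hf => ?_)
  · have : IsIso ((restrict (Noy.N a)).map f) := hf
    refine (isIso_restrict_sheafify_iff T f).1 ?_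
    rw [Functor.comp_map]
    infer_instance
  · exact map_restrict_iotaLocalIsos T f hf

/-- Sheaves for `T` are equivalent to sheaves for `ι(T)`. -/
def sheafEquiv (T : GTop a) : Sh T ≌ HSh (iota a T) :=
  Localization.uniq (restrict (Noy.N a) ⋙ sheafify T) (sheafify (iota a T)) (iotaLocalIsos T)

/-- The equivalence of sheaf categories is compatible with the functors from `a`. -/
def sheafYonedaEquivIso (T : GTop a) :
    sheafYoneda T ⋙ (sheafEquiv T).functor ≅ homologicalYoneda (iota a T) :=
  Functor.isoWhiskerRight
      (Functor.isoWhiskerRight (yonedaRestrictIso (Noy.N a)).symm (sheafify T)) _ ≪≫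
    Functor.isoWhiskerLeft (Noy.N a ⋙ yonedaPSh (Noy a))
      (Localization.compUniqFunctor (restrict (Noy.N a) ⋙ sheafify T) (sheafify (iota a T))
        (iotaLocalIsos T))

/-- An exact functor on presheaves over `Noy a` whose topology comes from a topology on `a`
restricts to a prexact functor on `a`. -/
lemma prexact_of_coveringSystem_eq_iota {C : Type w} [Category.{v₁} C] [Abelian C]
    [HasCoproducts.{v} C] (Ψ : PSh (Noy a) ⥤ C) [PreservesColimitsOfSize.{v, v} Ψ]
    [PreservesFiniteLimits Ψ] (T : GTop a)
    (h : coveringSystem (yonedaPSh (Noy a) ⋙ Ψ) = (iota a T).1) :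
    Prexact (Noy.N a ⋙ yonedaPSh (Noy a) ⋙ Ψ) := by
  refine ⟨extend (Noy.N a) ⋙ Ψ, inferInstance,
    ⟨Functor.isoWhiskerRight (yonedaExtendIso (Noy.N a)) Ψ⟩,
    preservesFiniteLimits_of_preservesMono _ fun {A B} m _ => ?_⟩
  -- Extension along `N` is not assumed exact, so `extend m` may have a kernel. It restricts to
  -- zero, as `extend m` restricts to `m` up to isomorphism; hence restriction followed by
  -- `T`-sheafification kills it, and so does `Ψ`, which has the same covering system.
  rw [Functor.comp_map, mono_map_iff]
  have hm : Mono ((restrict (Noy.N a)).map ((extend (Noy.N a)).map m)) := by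
    have := ((extendAdj (Noy.N a)).unit.naturality m)
    have h' : (restrict (Noy.N a)).map ((extend (Noy.N a)).map m) =
        inv (toExtend (Noy.N a) A) ≫ m ≫ toExtend (Noy.N a) B := by
      rw [IsIso.eq_inv_comp]
      exact this.symm
    rw [h']
    infer_instance
  have hk : (restrict (Noy.N a)).map (kernel.ι ((extend (Noy.N a)).map m)) = 0 := by
    rw [← cancel_mono ((restrict (Noy.N a)).map ((extend (Noy.N a)).map m)), ← Functor.map_comp,
      kernel.condition, Functor.map_zero, zero_comp]
  have hz : IsZero ((restrict (Noy.N a)).obj (kernel ((extend (Noy.N a)).map m))) :=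
    IsZero.of_mono_eq_zero _ hk
  have : IsIso ((restrict (Noy.N a)).map (0 : 0 ⟶ kernel ((extend (Noy.N a)).map m))) :=
    ⟨0, ((restrict (Noy.N a)).map_isZero (isZero_zero _)).eq_of_src _ _, hz.eq_of_src _ _⟩
  have : IsIso (Ψ.map (0 : 0 ⟶ kernel ((extend (Noy.N a)).map m))) := by
    rw [isIso_map_iff_of_coveringSystem_eq Ψ (restrict (Noy.N a) ⋙ sheafify T)
      (h.trans (coveringSystem_restrict_sheafify T).symm), Functor.comp_map]
    infer_instance
  infer_instance

variable {b : Type u'} [Category.{v} b] [Preadditive b] [HasZeroObject b] [EssentiallySmall.{v} b]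
  (φ : a ⥤ b) [φ.Additive]

instance [HasBinaryBiproducts a] : PreservesFiniteLimits (extend (Noy.mapNoy φ)) :=
  (Noy.isFlat_mapNoy φ).preservesFiniteLimits_extend

/-- The restriction to `a` of the functor on presheaves over `Noy a` induced by `φ`. -/
def nExtendSheafifyIso (R : HTop b) :
    Noy.N a ⋙ yonedaPSh (Noy a) ⋙ extend (Noy.mapNoy φ) ⋙ sheafify R ≅
      φ ⋙ homologicalYoneda R :=
  Functor.isoWhiskerLeft (Noy.N a)
      (Functor.isoWhiskerRight (yonedaExtendIso (Noy.mapNoy φ)) (sheafify R)) ≪≫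
    Functor.isoWhiskerRight (Noy.nMapNoyIso φ) (yonedaPSh (Noy b) ⋙ sheafify R)

/-- The functor `vec (φ ⋙ HZ)` extends to presheaves over `Noy a`. -/
def vecHomologicalYonedaIso [HasBinaryBiproducts a] (R : HTop b) :
    yonedaPSh (Noy a) ⋙ extend (Noy.mapNoy φ) ⋙ sheafify R ≅
      Noy.vec (φ ⋙ homologicalYoneda R) :=
  Noy.vecIso (Noy.preservesKernels_yonedaPSh.comp (extend (Noy.mapNoy φ) ⋙ sheafify R)) _
    (nExtendSheafifyIso φ R)

lemma prexact_vec_homologicalYoneda [HasBinaryBiproducts a] (R : HTop b) :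
    Prexact (Noy.vec (φ ⋙ homologicalYoneda R)) :=
  ⟨extend (Noy.mapNoy φ) ⋙ sheafify R, inferInstance, ⟨vecHomologicalYonedaIso φ R⟩,
    inferInstance⟩

/-- The function on homological topologies induced by an additive functor. -/
def inducedHTop [HasBinaryBiproducts a] (R : HTop b) : HTop a :=
  ⟨coveringSystem (Noy.vec (φ ⋙ homologicalYoneda R)),
    (prexact_vec_homologicalYoneda φ R).isTopology⟩

/-- If the induced topology is `ι(T)`, the exact extension of `vec (φ ⋙ HZ)` shows that `φ ⋙ HZ` is
prexact, and injectivity of `ι` identifies its topology with `T`. The converse is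
`Prexact.coveringSystem_vec`. -/
lemma inducedHTop_eq_iota_iff [HasBinaryBiproducts a] (R : HTop b) (T : GTop a) :
    inducedHTop φ R = iota a T ↔ Prexact (φ ⋙ homologicalYoneda R) ∧
      coveringSystem (φ ⋙ homologicalYoneda R) = T.1 := by
  constructor
  · intro h
    have hp : Prexact (φ ⋙ homologicalYoneda R) :=
      (prexact_of_coveringSystem_eq_iota (extend (Noy.mapNoy φ) ⋙ sheafify R) T
        ((coveringSystem_congr (vecHomologicalYonedaIso φ R)).trans
          (congr_arg Subtype.val h))).of_iso (nExtendSheafifyIso φ R)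
    refine ⟨hp, ?_⟩
    have h' : iota a ⟨_, hp.isTopology⟩ = iota a T :=
      Subtype.ext (hp.coveringSystem_vec.symm.trans (congr_arg Subtype.val h))
    exact congr_arg Subtype.val ((iota a).injective h')
  · rintro ⟨hp, h⟩
    refine Subtype.ext (hp.coveringSystem_vec.trans ?_)
    rw [h]
    rfl

end Main

/-! ### Transport along the equivalence of sheaf categories -/

section Transport

variable {a : Type u} [Category.{v} a] [Preadditive a] {b : Type u'} [Category.{v} b]
  [Preadditive b] [EssentiallySmall.{v} b]

lemma Prexact.isTopology_of_sheaves [EssentiallySmall.{v} a] {T : GTop b} {θ : a ⥤ Sh T}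
    (h : Prexact θ) : IsTopology (coveringSystem θ) :=
  letI := abelianSh T
  h.isTopology

variable [HasZeroObject b] (φ : a ⥤ b)

lemma prexact_comp_sheafYoneda_iff (T : GTop b) :
    Prexact (φ ⋙ sheafYoneda T) ↔ Prexact (φ ⋙ homologicalYoneda (iota b T)) := by
  constructor
  · intro h
    exact (h.comp_equivalence (sheafEquiv T).functor).of_iso
      (Functor.isoWhiskerLeft φ (sheafYonedaEquivIso T))
  · intro h
    exact (h.comp_equivalence (sheafEquiv T).inverse).of_iso
      (Functor.isoWhiskerLeft φ (Functor.isoWhiskerRight (sheafYonedaEquivIso T).symm _ ≪≫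
        Functor.associator _ _ _ ≪≫
          Functor.isoWhiskerLeft (sheafYoneda T) (sheafEquiv T).unitIso.symm ≪≫
            Functor.rightUnitor _))

lemma coveringSystem_comp_homologicalYoneda_iota (T : GTop b) :
    coveringSystem (φ ⋙ homologicalYoneda (iota b T)) = coveringSystem (φ ⋙ sheafYoneda T) := by
  rw [← coveringSystem_comp_equivalence (φ ⋙ sheafYoneda T) (sheafEquiv T).functor]
  exact (coveringSystem_congr (Functor.isoWhiskerLeft φ (sheafYonedaEquivIso T))).symm

end Transport

end HomologicalTopology

end

/-! ### The theorem -/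

theorem mainTheorem5 :
    ∃ ι : ∀ (a : Type u) [Category.{v} a] [Preadditive a] [HasZeroObject a] [HasBinaryBiproducts a]
        [EssentiallySmall.{v} a], GTop a ↪ HTop a,
      (∀ (a : Type u) [Category.{v} a] [Preadditive a] [HasZeroObject a] [HasBinaryBiproducts a]
          [EssentiallySmall.{v} a],
        (∀ T : GTop a, ∃ e : Sh T ≌ HSh (ι a T),
          Nonempty (sheafYoneda T ⋙ e.functor ≅ homologicalYoneda (ι a T))) ∧
        (∀ (C : Type w) [Category.{v₁} C] [Abelian C] [HasCoproducts.{v} C]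
            (θ : a ⥤ C) [θ.Additive], Prexact θ →
          ∃ (hθ : IsTopology (coveringSystem θ)) (hv : IsTopology (coveringSystem (Noy.vec θ))),
            Prexact (Noy.vec θ) ∧
              ι a ⟨coveringSystem θ, hθ⟩ = ⟨coveringSystem (Noy.vec θ), hv⟩) ∧
        Set.range (ι a) = {R : HTop a | ∀ f : Noy a, Noy.canonicalSieve f ∈ R.1 f}) ∧
      (∀ (a b : Type u) [Category.{v} a] [Preadditive a] [HasZeroObject a] [HasBinaryBiproducts a]
          [EssentiallySmall.{v} a] [Category.{v} b] [Preadditive b] [HasZeroObject b]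
          [HasBinaryBiproducts b] [EssentiallySmall.{v} b] (φ : a ⥤ b) [φ.Additive],
        (∀ T : GTop b, (inducedTop φ T).Dom ↔ Prexact (φ ⋙ sheafYoneda T)) ∧
        ∃ Φ : HTop b → HTop a,
          (∀ R : HTop b, Prexact (Noy.vec (φ ⋙ homologicalYoneda R)) ∧
            (Φ R).1 = coveringSystem (Noy.vec (φ ⋙ homologicalYoneda R))) ∧
          ∀ (T : GTop b) (T' : GTop a), T' ∈ inducedTop φ T ↔ Φ (ι b T) = ι a T') := by
  refine ⟨fun a => iota a, fun a => ⟨fun T => ⟨sheafEquiv T, ⟨sheafYonedaEquivIso T⟩⟩,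
    fun C _ _ _ θ _ hθ => ⟨hθ.isTopology, hθ.vec.isTopology, hθ.vec,
      Subtype.ext hθ.coveringSystem_vec.symm⟩, range_iota⟩,
    -- The domain of `inducedTop` also asks for a topology, which prexactness supplies.
    fun a b _ _ _ _ _ _ _ _ _ _ φ _ => ⟨fun T => ⟨fun h => h.1, fun h => ⟨h, h.isTopology_of_sheaves⟩⟩,
      inducedHTop φ, fun R => ⟨prexact_vec_homologicalYoneda φ R, rfl⟩, fun T T' => ?_⟩⟩
  rw [inducedHTop_eq_iota_iff, ← prexact_comp_sheafYoneda_iff,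
    coveringSystem_comp_homologicalYoneda_iota]
  constructor
  · rintro ⟨h, rfl⟩
    exact ⟨h.1, rfl⟩
  · rintro ⟨h, h'⟩
    exact ⟨⟨h, h.isTopology_of_sheaves⟩, Subtype.ext h'⟩
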